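/- Let $k$ be a perfect field of characteristic $p>0$. For a Weierstrass equation $Y^2Z+a_1XYZ+a_3YZ^2=X^3+a_2X^2Z+a_4XZ^2+a_6Z^3$ over a commutative ring $R$, let $\mathcal U=\{Y\neq 0\}$ be the affine neighbourhood of the neutral element $O$ with coordinates $z=-X/Y$, $w=-Z/Y$, on which the curve has equation $w-a_1zw-a_3w^2=z^3+a_2z^2w+a_4zw^2+a_6w^3$. Consider on $\mathcal U$ the vector field $$P=(a_1w+3z^2+2a_2zw+a_4w^2)\,\partial_w+(1-a_1z-2a_3w-a_2z^2-2a_4zw-3a_6w^2)\,\partial_z ,$$ and let $\omega=\dfrac{dz}{1-a_1z-2a_3w-a_2z^2-2a_4zw-3a_6w^2}=\Big(\sum_{i\ge 0}\alpha_{i+1}z^i\Big)dz$ be the expansion at $O$ of the invariant differential. For a polynomial $\beta\in\mathbb Z[b_{-1},b_{-2},\dots]$ let $\Psi(\beta)\in R[P]$ be its image under $b_{-j}\mapsto \alpha_jP$ $(j\ge 1)$. For a polynomial $q(P)$ in $P$ with coefficients depending on the equation and an integer $n\ge 1$, the operator $q(P)/n$ on $\mathcal U$ over $k$ (where $n$ may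 vanish) is understood as the $k$-linear endomorphism $E$ of $\mathcal O(\mathcal U)$ such that for every lift of the equation to a ring $R$ with torsion-free additive group equipped with a homomorphism $R\to k$ (within the given family of equations), the operator $q(P)$ on the chart $\mathcal O(\mathcal U_R)$ of the lifted equation is divisible by $n$, that is, $q(P)=nQ$ for an $R$-linear endomorphism $Q$ of $\mathcal O(\mathcal U_R)$, and $E$ is the reduction of $Q$. Saying that $q(P)/n$ belongs to $H^0(J,\mathcal D_J)$ means that such an $E$ exists, is unique, and is the restriction to $\mathcal U$ of a global section of the sheaf $\mathcal D_J$ of differential operators (in Grothendieck's sense) on the projective curve $J$ over $k$. 1. For every elliptic curve $X=J$ over $k$ in Weierstrass form (family: all Weierstrass equations), $P$ is the restriction to $\mathcal U$ of an element of $H^0(J,\mathcal D_J)$, and the images $$\frac{\Psi(b_{-1}^2+b_{-2})}{2!},\qquad \frac{\Psi(b_{-2}^2+b_{-4})}{2!}$$ of $\frac{b_{-1}^2+b_{-2}}{2!}$ and $\frac{b_{-2}^2+b_{-4}}{2!}$ belong to $H^0(J,\mathcal D_J)$. 2. Over every commutative ring, $\Psi(b_{-1}^2+b_{-2})=P^2+a_1P$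 and $\Psi(b_{-2}^2+b_{-4})=a_1^2P^2+(a_1^3+2a_1a_2+2a_3)P$. Thus the first operator in 1 is $\frac{P^2+a_1P}{2!}$. 3. For every $\lambda\in k$ such that the Legendre curve $y^2=x(x-1)(x-\lambda)$ is an elliptic curve $X=J$ over $k$ (family: all Legendre equations), the operators $$\frac{P^2}{2!},\qquad \frac{P^3-2(1+\lambda)P}{3!}$$ belong to $H^0(J,\mathcal D_J)$. -/

import Mathlib

open AlgebraicGeometry CategoryTheory CategoryTheory.Limits

universe u

noncomputable section

/-! ### Differential operators -/

/-- An additive endomorphism `D` of a commutative ring `A` is a differential operator of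
order `≤ n` (Grothendieck): order `≤ 0` means `A`-linear, and order `≤ n + 1` means that
`b ↦ D (a * b) - a * D b` has order `≤ n` for every `a`. -/
def IsDiffOpLE {A : Type*} [CommRing A] : ℕ → (A →+ A) → Prop
  | 0, D => ∀ a b, D (a * b) = a * D b
  | n + 1, D => ∀ a, IsDiffOpLE n
      (D.comp (AddMonoidHom.mulLeft a) - (AddMonoidHom.mulLeft a).comp D)

/-- A global section of the sheaf `𝒟_X` of differential operators (in the sense of EGA IV, 16.8)
of a `k`-scheme `X`: a `k`-linear endomorphism of the sheaf `𝒪_X` which is, locally on `X`,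
of finite order. -/
structure GlobalDiffOp {k : Type u} [CommRing k] {X : Scheme.{u}}
    (s : X ⟶ Spec (CommRingCat.of k)) where
  /-- the action on the sections over each open set -/
  op : ∀ U : X.Opens, Γ(X, U) →+ Γ(X, U)
  /-- linearity over the base ring -/
  op_base : ∀ (U : X.Opens) (c : Γ(Spec (CommRingCat.of k), ⊤)) (f : Γ(X, U)),
    op U (s.appLE ⊤ U le_top c * f) = s.appLE ⊤ U le_top c * op U f
  /-- compatibility with restriction -/
  op_res : ∀ (U V : X.Opens) (h : V ≤ U) (f : Γ(X, U)),
    op V (X.presheaf.map (homOfLE h).op f) = X.presheaf.map (homOfLE h).op (op U f)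
  /-- locally of finite order -/
  locally_finite_order : ∀ x : X, ∃ U : X.Opens, x ∈ U ∧ ∃ n : ℕ,
    ∀ V : X.Opens, V ≤ U → IsDiffOpLE n (op V)

/-- The endomorphism `E` of the ring `B` is the restriction of the global differential operator
`D` to the affine open subscheme `ι : Spec B ⟶ X`. -/
def GlobalDiffOp.RestrictsTo {k : Type u} [CommRing k] {X : Scheme.{u}}
    {s : X ⟶ Spec (CommRingCat.of k)} (D : GlobalDiffOp s)
    {B : Type u} [CommRing B] [Algebra k B] (ι : Spec (CommRingCat.of B) ⟶ X)
    [IsOpenImmersion ι] (E : Module.End k B) : Prop :=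
  let θ : Γ(X, ι.opensRange) →+* B :=
    ((ι.appLE ι.opensRange ⊤ (fun x _ => ⟨x, rfl⟩)) ≫
      (Scheme.ΓSpecIso (CommRingCat.of B)).hom).hom
  ∀ f : Γ(X, ι.opensRange), θ (D.op ι.opensRange f) = E (θ f)

namespace WeierstrassCurve

variable {R : Type u} [CommRing R] (W : WeierstrassCurve R)

/-! ### The chart around the neutral element, with coordinates `z = -x/y` and `w = -1/y` -/

/-- The coordinate `z`, as a polynomial. -/
abbrev zz : MvPolynomial (Fin 2) R := MvPolynomial.X 0

/-- The coordinate `w`, as a polynomial. -/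
abbrev ww : MvPolynomial (Fin 2) R := MvPolynomial.X 1

open MvPolynomial in
/-- The equation `w - a₁zw - a₃w² - (z³ + a₂z²w + a₄zw² + a₆w³)` of the curve near the neutral
element. -/
def eqO : MvPolynomial (Fin 2) R :=
  ww - C W.a₁ * zz * ww - C W.a₃ * ww ^ 2
    - (zz ^ 3 + C W.a₂ * zz ^ 2 * ww + C W.a₄ * zz * ww ^ 2 + C W.a₆ * ww ^ 3)

/-- The coordinate ring `R[z, w]/(eqO)` of the affine neighbourhood `{Y ≠ 0}` of the neutral
element. -/
abbrev ChartO : Type u := MvPolynomial (Fin 2) R ⧸ Ideal.span {W.eqO}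

/-- `z` on the curve. -/
abbrev zO : W.ChartO := Ideal.Quotient.mk _ zz

/-- `w` on the curve. -/
abbrev wO : W.ChartO := Ideal.Quotient.mk _ ww

open MvPolynomial in
/-- The vector field
`(a₁w + 3z² + 2a₂zw + a₄w²) ∂_w + (1 - a₁z - 2a₃w - a₂z² - 2a₄zw - 3a₆w²) ∂_z`
on the `(z, w)`-plane. -/
def planeField : Derivation R (MvPolynomial (Fin 2) R) (MvPolynomial (Fin 2) R) :=
  (C W.a₁ * ww + 3 * zz ^ 2 + 2 * C W.a₂ * zz * ww + C W.a₄ * ww ^ 2) • pderiv 1 +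
  (1 - C W.a₁ * zz - 2 * C W.a₃ * ww - C W.a₂ * zz ^ 2 - 2 * C W.a₄ * zz * ww
    - 3 * C W.a₆ * ww ^ 2) • pderiv 0

lemma planeField_eqO : W.planeField W.eqO = 0 := by
  simp only [planeField, eqO, Derivation.add_apply, Derivation.smul_apply, map_sub, map_add,
    Derivation.leibniz, Derivation.leibniz_pow, MvPolynomial.pderiv_C, smul_eq_mul, nsmul_eq_mul,
    MvPolynomial.pderiv_X_self, MvPolynomial.pderiv_X_of_ne (show (0 : Fin 2) ≠ 1 by decide),
    MvPolynomial.pderiv_X_of_ne (show (1 : Fin 2) ≠ 0 by decide)]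
  push_cast
  ring

lemma planeField_mem (f : MvPolynomial (Fin 2) R)
    (hf : Ideal.Quotient.mkₐ R (Ideal.span {W.eqO}) f = 0) :
    Ideal.Quotient.mkₐ R (Ideal.span {W.eqO}) (W.planeField f) = 0 := by
  rw [Ideal.Quotient.mkₐ_eq_mk, Ideal.Quotient.eq_zero_iff_mem, Ideal.mem_span_singleton] at *
  obtain ⟨g, rfl⟩ := hf
  rw [Derivation.leibniz, W.planeField_eqO]
  simp

/-- The invariant vector field `P` on the chart around the neutral element. -/
def invField : Derivation R W.ChartO W.ChartO :=
  Derivation.liftOfSurjective (f := Ideal.Quotient.mkₐ R (Ideal.span {W.eqO}))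
    (Ideal.Quotient.mkₐ_surjective R _) (d := W.planeField) W.planeField_mem

/-- `P` as an `R`-linear endomorphism of the coordinate ring. -/
def invOp : Module.End R W.ChartO := W.invField.toLinearMap

lemma map_eqO {S : Type*} [CommRing S] (φ : R →+* S) :
    MvPolynomial.map φ W.eqO = (W.map φ).eqO := by
  simp [eqO]

/-- Reduction of functions on the chart along a ring homomorphism `φ : R → k` sending the
coefficients of `V` to those of `W`. -/
def chartRed {k : Type u} [CommRing k] {V : WeierstrassCurve R} {W : WeierstrassCurve k}
    (φ : R →+* k) (h : V.map φ = W) : V.ChartO →+* W.ChartO :=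
  Ideal.quotientMap _ (MvPolynomial.map φ) (by
    rw [Ideal.span_singleton_le_iff_mem, Ideal.mem_comap, V.map_eqO φ, h]
    exact Ideal.mem_span_singleton_self _)

/-! ### The projective curve, glued from the charts `{Z ≠ 0}` and `{Y ≠ 0}` -/

open Polynomial in
/-- `x` on the affine chart `{Z ≠ 0}`. -/
abbrev xA : W.toAffine.CoordinateRing := Affine.CoordinateRing.mk W.toAffine (C X)

open Polynomial in
/-- `y` on the affine chart `{Z ≠ 0}`. -/
abbrev yA : W.toAffine.CoordinateRing := Affine.CoordinateRing.mk W.toAffine X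

/-- The coordinate ring of `{Z ≠ 0} ∩ {Y ≠ 0}`. -/
abbrev Overlap : Type u := Localization.Away W.yA

/-- The inverse of `y` on the overlap. -/
abbrev yInv : W.Overlap := IsLocalization.Away.invSelf W.yA

lemma y_mul_yInv : algebraMap _ W.Overlap W.yA * W.yInv = 1 :=
  IsLocalization.Away.mul_invSelf W.yA

lemma eqA : W.yA ^ 2 + algebraMap R _ W.a₁ * W.xA * W.yA + algebraMap R _ W.a₃ * W.yA =
    W.xA ^ 3 + algebraMap R _ W.a₂ * W.xA ^ 2 + algebraMap R _ W.a₄ * W.xA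
      + algebraMap R _ W.a₆ := by
  have h : Affine.CoordinateRing.mk W.toAffine W.toAffine.polynomial = 0 := AdjoinRoot.mk_self
  have e : ∀ r : R, algebraMap R W.toAffine.CoordinateRing r =
      Affine.CoordinateRing.mk W.toAffine (Polynomial.C (Polynomial.C r)) := fun r => by
    rw [IsScalarTower.algebraMap_apply R (Polynomial R) W.toAffine.CoordinateRing]
    exact congrArg _ (by simp)
  simp only [Affine.polynomial, map_add, map_mul, map_sub, map_pow] at h
  simp only [e]
  linear_combination h

lemma eqO_eq_zero : W.wO - algebraMap R _ W.a₁ * W.zO * W.wO - algebraMap R _ W.a₃ * W.wO ^ 2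
    - (W.zO ^ 3 + algebraMap R _ W.a₂ * W.zO ^ 2 * W.wO + algebraMap R _ W.a₄ * W.zO * W.wO ^ 2
      + algebraMap R _ W.a₆ * W.wO ^ 3) = 0 :=
  (Ideal.Quotient.eq_zero_iff_mem).2 (Ideal.mem_span_singleton_self W.eqO)

/-- The change of variables `z = -x/y`, `w = -1/y`, from functions on `{Y ≠ 0}` to functions on
the overlap. -/
def chartOToOverlap : W.ChartO →ₐ[R] W.Overlap :=
  Ideal.Quotient.liftₐ _
    (MvPolynomial.aeval ![-(algebraMap _ W.Overlap W.xA * W.yInv), -W.yInv]) (by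
      intro a ha
      obtain ⟨g, rfl⟩ := Ideal.mem_span_singleton.1 ha
      rw [map_mul]
      convert zero_mul _
      have h1 := W.y_mul_yInv
      have h2 := congrArg (algebraMap _ W.Overlap) W.eqA
      simp only [map_add, map_mul, map_pow, ← IsScalarTower.algebraMap_apply] at h2
      simp only [eqO, map_sub, map_add, map_mul, map_pow, MvPolynomial.aeval_X,
        MvPolynomial.algHom_C, Matrix.cons_val_zero, Matrix.cons_val_one]
      generalize algebraMap _ W.Overlap W.xA = x at *
      generalize algebraMap _ W.Overlap W.yA = y at *
      generalize W.yInv = v at *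
      linear_combination (-v ^ 3) * h2 + (v * (y * v + 1) + algebraMap R W.Overlap W.a₁ * x * v ^ 2
        + algebraMap R W.Overlap W.a₃ * v ^ 2) * h1)

lemma chartOToOverlap_zO :
    W.chartOToOverlap W.zO = -(algebraMap _ W.Overlap W.xA * W.yInv) :=
  (Ideal.Quotient.lift_mk _ _ _).trans (by simp)

lemma chartOToOverlap_wO : W.chartOToOverlap W.wO = -W.yInv :=
  (Ideal.Quotient.lift_mk _ _ _).trans (by simp)

/-- The coordinate ring of the open subset `{w ≠ 0}` of the chart `{Y ≠ 0}`; it is isomorphic to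
`W.Overlap`, see `overlapEquiv` below. -/
abbrev OverlapO : Type u := Localization.Away W.wO

/-- The inverse of `w` on `{w ≠ 0}`. -/
abbrev wInv : W.OverlapO := IsLocalization.Away.invSelf W.wO

lemma w_mul_wInv : algebraMap _ W.OverlapO W.wO * W.wInv = 1 :=
  IsLocalization.Away.mul_invSelf W.wO

/-- The change of variables `x = z/w`, `y = -1/w`. -/
def chartAToOverlapO : W.toAffine.CoordinateRing →+* W.OverlapO :=
  AdjoinRoot.lift
    (Polynomial.aeval (R := R) (algebraMap _ W.OverlapO W.zO * W.wInv)).toRingHom (-W.wInv) (by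
      have h1 := W.w_mul_wInv
      have h2 := congrArg (algebraMap _ W.OverlapO) W.eqO_eq_zero
      simp only [map_add, map_sub, map_mul, map_pow, map_zero,
        ← IsScalarTower.algebraMap_apply] at h2
      simp only [Affine.polynomial, Polynomial.eval₂_add, Polynomial.eval₂_sub,
        Polynomial.eval₂_mul, Polynomial.eval₂_pow, Polynomial.eval₂_X, Polynomial.eval₂_C,
        AlgHom.toRingHom_eq_coe, RingHom.coe_coe, map_add, map_mul, map_pow, Polynomial.aeval_X,
        Polynomial.aeval_C]
      generalize algebraMap _ W.OverlapO W.zO = z at *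
      generalize algebraMap _ W.OverlapO W.wO = w at *
      generalize W.wInv = v at *
      linear_combination v ^ 3 * h2 - (v ^ 2 - algebraMap R W.OverlapO W.a₁ * z * v ^ 2
        - algebraMap R W.OverlapO W.a₃ * v * (w * v + 1)
        - algebraMap R W.OverlapO W.a₂ * z ^ 2 * v ^ 2
        - algebraMap R W.OverlapO W.a₄ * z * v * (w * v + 1)
        - algebraMap R W.OverlapO W.a₆ * (w ^ 2 * v ^ 2 + w * v + 1)) * h1)

lemma chartAToOverlapO_xA :
    W.chartAToOverlapO W.xA = algebraMap _ W.OverlapO W.zO * W.wInv := by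
  refine (AdjoinRoot.lift_of _).trans ?_
  simp

lemma chartAToOverlapO_yA : W.chartAToOverlapO W.yA = -W.wInv :=
  AdjoinRoot.lift_root _

lemma chartAToOverlapO_algebraMap (r : R) :
    W.chartAToOverlapO (algebraMap R _ r) = algebraMap R _ r := by
  rw [IsScalarTower.algebraMap_apply R (Polynomial R) W.toAffine.CoordinateRing]
  refine (AdjoinRoot.lift_of _).trans ?_
  simp

/-- `chartAToOverlapO`, as an `R`-algebra homomorphism. -/
def chartAToOverlapOₐ : W.toAffine.CoordinateRing →ₐ[R] W.OverlapO :=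
  { W.chartAToOverlapO with commutes' := W.chartAToOverlapO_algebraMap }

lemma isUnit_wInv : IsUnit W.wInv :=
  IsUnit.of_mul_eq_one _ ((mul_comm _ _).trans W.w_mul_wInv)

lemma isUnit_yInv : IsUnit W.yInv :=
  IsUnit.of_mul_eq_one _ ((mul_comm _ _).trans W.y_mul_yInv)

/-- From functions on `{w ≠ 0}` to functions on the overlap. -/
def overlapHom : W.OverlapO →ₐ[R] W.Overlap :=
  IsLocalization.liftAlgHom (M := Submonoid.powers W.wO) (f := W.chartOToOverlap) (by
    rintro ⟨_, n, rfl⟩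
    simp only [map_pow, chartOToOverlap_wO]
    exact W.isUnit_yInv.neg.pow n)

/-- From functions on the overlap to functions on `{w ≠ 0}`. -/
def overlapInv : W.Overlap →ₐ[R] W.OverlapO :=
  IsLocalization.liftAlgHom (M := Submonoid.powers W.yA) (f := W.chartAToOverlapOₐ) (by
    rintro ⟨_, n, rfl⟩
    simp only [map_pow]
    refine IsUnit.pow n ?_
    change IsUnit (W.chartAToOverlapO W.yA)
    rw [chartAToOverlapO_yA]
    exact W.isUnit_wInv.neg)

lemma overlapHom_algebraMap (f : W.ChartO) :
    W.overlapHom (algebraMap _ W.OverlapO f) = W.chartOToOverlap f :=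
  IsLocalization.lift_eq _ f

lemma overlapInv_algebraMap (f : W.toAffine.CoordinateRing) :
    W.overlapInv (algebraMap _ W.Overlap f) = W.chartAToOverlapO f :=
  IsLocalization.lift_eq _ f

lemma overlapHom_wInv : W.overlapHom W.wInv = -algebraMap _ W.Overlap W.yA := by
  have h1 := congrArg W.overlapHom W.w_mul_wInv
  rw [map_mul, map_one, overlapHom_algebraMap, chartOToOverlap_wO] at h1
  have h2 := W.y_mul_yInv
  linear_combination (-algebraMap _ W.Overlap W.yA) * h1 - W.overlapHom W.wInv * h2

lemma overlapInv_yInv : W.overlapInv W.yInv = -algebraMap _ W.OverlapO W.wO := by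
  have h1 := congrArg W.overlapInv W.y_mul_yInv
  rw [map_mul, map_one, overlapInv_algebraMap, chartAToOverlapO_yA] at h1
  have h2 := W.w_mul_wInv
  linear_combination (-algebraMap _ W.OverlapO W.wO) * h1 - W.overlapInv W.yInv * h2

lemma overlapHom_overlapInv (f : W.Overlap) : W.overlapHom (W.overlapInv f) = f := by
  suffices h : (W.overlapHom.toRingHom.comp W.overlapInv.toRingHom) = RingHom.id _ from
    RingHom.congr_fun h f
  apply IsLocalization.ringHom_ext (Submonoid.powers W.yA)
  refine AdjoinRoot.ringHom_ext (Polynomial.ringHom_ext ?_ ?_) ?_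
  · intro r
    change W.overlapHom (W.overlapInv (algebraMap _ W.Overlap
      (AdjoinRoot.of W.toAffine.polynomial (Polynomial.C r)))) = algebraMap _ W.Overlap
      (AdjoinRoot.of W.toAffine.polynomial (Polynomial.C r))
    have e : AdjoinRoot.of W.toAffine.polynomial (Polynomial.C r) =
        algebraMap R W.toAffine.CoordinateRing r := by
      rw [IsScalarTower.algebraMap_apply R (Polynomial R) W.toAffine.CoordinateRing]
      simp
    rw [e, ← IsScalarTower.algebraMap_apply, AlgHom.commutes, AlgHom.commutes]
  · change W.overlapHom (W.overlapInv (algebraMap _ W.Overlap W.xA)) = algebraMap _ W.Overlap W.xA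
    rw [overlapInv_algebraMap, chartAToOverlapO_xA, map_mul, overlapHom_algebraMap,
      chartOToOverlap_zO, overlapHom_wInv]
    linear_combination algebraMap _ W.Overlap W.xA * W.y_mul_yInv
  · change W.overlapHom (W.overlapInv (algebraMap _ W.Overlap W.yA)) = algebraMap _ W.Overlap W.yA
    rw [overlapInv_algebraMap, chartAToOverlapO_yA, map_neg, overlapHom_wInv, neg_neg]

lemma overlapInv_overlapHom (f : W.OverlapO) : W.overlapInv (W.overlapHom f) = f := by
  suffices h : (W.overlapInv.toRingHom.comp W.overlapHom.toRingHom) = RingHom.id _ from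
    RingHom.congr_fun h f
  apply IsLocalization.ringHom_ext (Submonoid.powers W.wO)
  refine Ideal.Quotient.ringHom_ext (MvPolynomial.ringHom_ext ?_ ?_)
  · intro r
    change W.overlapInv (W.overlapHom (algebraMap _ W.OverlapO (algebraMap R W.ChartO r))) =
      algebraMap _ W.OverlapO (algebraMap R W.ChartO r)
    rw [← IsScalarTower.algebraMap_apply, AlgHom.commutes, AlgHom.commutes]
  · intro i
    fin_cases i
    · change W.overlapInv (W.overlapHom (algebraMap _ W.OverlapO W.zO)) =
        algebraMap _ W.OverlapO W.zO
      rw [overlapHom_algebraMap, chartOToOverlap_zO, map_neg, map_mul, overlapInv_algebraMap,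
        chartAToOverlapO_xA, overlapInv_yInv]
      linear_combination algebraMap _ W.OverlapO W.zO * W.w_mul_wInv
    · change W.overlapInv (W.overlapHom (algebraMap _ W.OverlapO W.wO)) =
        algebraMap _ W.OverlapO W.wO
      rw [overlapHom_algebraMap, chartOToOverlap_wO, map_neg, overlapInv_yInv, neg_neg]

/-- The overlap, seen from both charts. -/
def overlapEquiv : W.OverlapO ≃ₐ[R] W.Overlap :=
  AlgEquiv.ofAlgHom W.overlapHom W.overlapInv
    (AlgHom.ext W.overlapHom_overlapInv) (AlgHom.ext W.overlapInv_overlapHom)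

/-- The open immersion of the overlap in the chart `{Z ≠ 0}`. -/
def overlapToA : Spec (CommRingCat.of W.Overlap) ⟶ Spec (CommRingCat.of W.toAffine.CoordinateRing) :=
  Spec.map (CommRingCat.ofHom (algebraMap _ _))

/-- The open immersion of the overlap in the chart `{Y ≠ 0}`. -/
def overlapToO : Spec (CommRingCat.of W.Overlap) ⟶ Spec (CommRingCat.of W.ChartO) :=
  Spec.map (CommRingCat.ofHom W.chartOToOverlap.toRingHom)

instance : IsOpenImmersion W.overlapToA :=
  IsOpenImmersion.of_isLocalization W.yA

instance : IsOpenImmersion W.overlapToO := by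
  have h : W.overlapToO = Spec.map W.overlapEquiv.toRingEquiv.toCommRingCatIso.hom ≫
      Spec.map (CommRingCat.ofHom (algebraMap W.ChartO W.OverlapO)) := by
    rw [← Spec.map_comp, overlapToO]
    congr 1
    exact CommRingCat.hom_ext (RingHom.ext fun f => (W.overlapHom_algebraMap f).symm)
  have : IsOpenImmersion (Spec.map (CommRingCat.ofHom (algebraMap W.ChartO W.OverlapO))) :=
    IsOpenImmersion.of_isLocalization W.wO
  rw [h]
  infer_instance

/-- The projective curve `Y²Z + a₁XYZ + a₃YZ² = X³ + a₂X²Z + a₄XZ² + a₆Z³`, obtained by gluing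
its affine open subsets `{Z ≠ 0}` and `{Y ≠ 0}`, which cover it. -/
def curve : Scheme.{u} := pushout W.overlapToA W.overlapToO

/-- The chart `{Z ≠ 0}`. -/
def ιA : Spec (CommRingCat.of W.toAffine.CoordinateRing) ⟶ W.curve :=
  pushout.inl W.overlapToA W.overlapToO

/-- The chart `{Y ≠ 0}`, a neighbourhood of the neutral element. -/
def ιO : Spec (CommRingCat.of W.ChartO) ⟶ W.curve :=
  pushout.inr W.overlapToA W.overlapToO

instance : IsOpenImmersion W.ιA :=
  inferInstanceAs (IsOpenImmersion
    (colimit.ι (span W.overlapToA W.overlapToO) WalkingSpan.left))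

instance : IsOpenImmersion W.ιO :=
  inferInstanceAs (IsOpenImmersion
    (colimit.ι (span W.overlapToA W.overlapToO) WalkingSpan.right))

/-- The structure morphism of the curve. -/
def toBase : W.curve ⟶ Spec (CommRingCat.of R) :=
  pushout.desc (Spec.map (CommRingCat.ofHom (algebraMap R W.toAffine.CoordinateRing)))
    (Spec.map (CommRingCat.ofHom (algebraMap R W.ChartO))) (by
      rw [overlapToA, overlapToO, ← Spec.map_comp, ← Spec.map_comp]
      congr 1
      ext r
      exact (IsScalarTower.algebraMap_apply R W.toAffine.CoordinateRing W.Overlap r).symm.trans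
        (W.chartOToOverlap.commutes r).symm)

/-- The endomorphism `E` of the ring of functions on the chart around the neutral element is the
restriction of an element of `H⁰(J, 𝒟_J)`, where `J` is the projective curve. -/
def IsGlobal (E : Module.End R W.ChartO) : Prop :=
  ∃ D : GlobalDiffOp W.toBase, D.RestrictsTo W.ιO E

/-! ### The invariant differential and the images of elements of the Heisenberg algebra -/

open PowerSeries in
/-- The right hand side of `w = z³ + a₁zw + a₂z²w + a₃w² + a₄zw² + a₆w³`. -/
def wStep (f : PowerSeries R) : PowerSeries R :=
  X ^ 3 + C W.a₁ * X * f + C W.a₂ * X ^ 2 * f + C W.a₃ * f ^ 2 + C W.a₄ * X * f ^ 2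
    + C W.a₆ * f ^ 3

/-- The expansion `w(z) = z³ + ⋯` of `w` in powers of `z` at the neutral element: the iterates of
`wStep` converge `z`-adically, the coefficient of `zⁿ` being stationary from the `n`-th on. -/
def wSeries : PowerSeries R :=
  PowerSeries.mk fun n => PowerSeries.coeff n (W.wStep^[n] 0)

open PowerSeries in
/-- The expansion `∑ αᵢ₊₁ zⁱ = 1 + a₁z + ⋯` of the invariant differential
`ω = dx/(2y + a₁x + a₃) = dz/(1 - a₁z - 2a₃w - a₂z² - 2a₄zw - 3a₆w²) = (∑ αᵢ₊₁ zⁱ) dz`. -/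
def omegaSeries : PowerSeries R :=
  invOfUnit (1 - C W.a₁ * X - 2 * C W.a₃ * W.wSeries - C W.a₂ * X ^ 2
    - 2 * C W.a₄ * X * W.wSeries - 3 * C W.a₆ * W.wSeries ^ 2) 1

/-- The coefficient `α_j` of `z ^ (j - 1)` in the invariant differential, for `j ≥ 1`. -/
def alpha (j : ℕ+) : R := PowerSeries.coeff j.natPred W.omegaSeries

/-- The ring homomorphism sending `b₋ⱼ` to `α_j P`, `j ≥ 1`. The source is the polynomial ring
`ℤ[b₋₁, b₋₂, …]`, its variable of index `j` being `b₋ⱼ`; the image is written as a polynomial in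
the indeterminate `P`. -/
def heisImage : MvPolynomial ℕ+ ℤ →+* Polynomial R :=
  MvPolynomial.eval₂Hom (Int.castRingHom _)
    fun j => Polynomial.C (W.alpha j) * Polynomial.X

/-! ### Divided operators -/

/-- `E` is the operator `q(P) / n` on the chart around the neutral element of the curve `W`
over `k`. As `n` may vanish in `k`, this is understood as follows: for every lift `V` of `W`
(in a given family `𝓕` of Weierstrass equations) over a ring `R` without additive torsion, the
operator `q(P)` of `V` is divisible by `n`, and `E` is the reduction of the quotient. Here `q`
is a polynomial in `P` with coefficients depending on the Weierstrass equation. -/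
def IsDividedOp {k : Type u} [CommRing k] (W : WeierstrassCurve k)
    (𝓕 : ∀ (R : Type u) [CommRing R], Set (WeierstrassCurve R))
    (q : ∀ (R : Type u) [CommRing R], WeierstrassCurve R → Polynomial R) (n : ℕ)
    (E : Module.End k W.ChartO) : Prop :=
  ∀ (R : Type u) [CommRing R] [IsAddTorsionFree R] (φ : R →+* k) (V : WeierstrassCurve R)
    (h : V.map φ = W), V ∈ 𝓕 R →
    ∃ Q : Module.End R V.ChartO, n • Q = Polynomial.aeval V.invOp (q R V) ∧
      ∀ f : V.ChartO, E (chartRed φ h f) = chartRed φ h (Q f)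

/-- The operator `q(P) / n` is well defined on the chart around the neutral element, and belongs
to `H⁰(J, 𝒟_J)`. -/
def DividedOpIsGlobal {k : Type u} [CommRing k] (W : WeierstrassCurve k)
    (𝓕 : ∀ (R : Type u) [CommRing R], Set (WeierstrassCurve R))
    (q : ∀ (R : Type u) [CommRing R], WeierstrassCurve R → Polynomial R) (n : ℕ) : Prop :=
  ∃ E : Module.End k W.ChartO, W.IsDividedOp 𝓕 q n E ∧
    (∀ E' : Module.End k W.ChartO, W.IsDividedOp 𝓕 q n E' → E' = E) ∧ W.IsGlobal E

/-- The Legendre curve `y² = x(x - 1)(x - l)`. -/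
def legendre (l : R) : WeierstrassCurve R := ⟨0, -(1 + l), 0, l, 0⟩

end WeierstrassCurve

end

/-! ### Truncated Hasse–Schmidt derivations -/

/-! Translating functions by the point of formal parameter `t` is a ring homomorphism, and it is
defined over any base because the group law is. Its expansion in `t` is therefore a Hasse–Schmidt
derivation `(1, D₁, D₂, D₃, …)` with integral coefficients, while over a torsion-free base it equals
`exp (log(t) P)`. Hence `D₁ = P`, `2 D₂ = P² + a₁ P` and `6 D₃ = P³ + 3 a₁ P² + 2 (a₁² + a₂) P`: the
divided operators exist integrally because they are components of a ring homomorphism.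

Only the expansion modulo `t⁴` is needed, and it is given by explicit polynomials, so the group law
itself never appears. The formulas respect the equation in each chart (`equation_jetZ_jetW`,
`equation_jetX_jetY`) and the changes of variables `y w = -1`, `x w = z` (`jetY_mul_jetW`,
`jetX_mul_jetW`). They therefore glue to the projective curve (`exists_hasseSchmidt`), and the
components of the result are differential operators of order at most 1, 2, 3. The relations with `P`
are `jetO_c₁`, `two_mul_halfOp` and `six_mul_sixthOp`.

Every operator in the theorem is a combination of the `Dᵢ`: the second Heisenberg image divided by 2
is `a₁² D₂ + (a₁a₂ + a₃) P`, and the Legendre operators are `D₂` and `D₃` with `a₁ = 0`, `a₂ = -(1 +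
λ)`. Compatibility with every lift is the naturality of the formulas (`jetO_chartRed`). Uniqueness
follows from one lift, over a polynomial ring over `ℤ` mapping onto `k`: the chart of the lift has
no torsion (`chartO_eq_zero_of_natCast_mul`), so the quotient of `q(P)` by `n` is unique there, and
its reduction determines the operator over `k`. -/

/-- The ring `A[t]/(t⁴)`: the element with components `c₀, c₁, c₂, c₃` is
`c₀ + c₁ t + c₂ t² + c₃ t³`. -/
@[ext]
structure Jet (A : Type*) where
  /-- the constant coefficient -/
  c₀ : A
  /-- the coefficient of `t` -/
  c₁ : A
  /-- the coefficient of `t²` -/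
  c₂ : A
  /-- the coefficient of `t³` -/
  c₃ : A

namespace Jet

section Ring

variable {A B C : Type*} [CommRing A] [CommRing B] [CommRing C]

instance : Zero (Jet A) := ⟨⟨0, 0, 0, 0⟩⟩
instance : One (Jet A) := ⟨⟨1, 0, 0, 0⟩⟩
instance : Add (Jet A) := ⟨fun a b => ⟨a.c₀ + b.c₀, a.c₁ + b.c₁, a.c₂ + b.c₂, a.c₃ + b.c₃⟩⟩
instance : Neg (Jet A) := ⟨fun a => ⟨-a.c₀, -a.c₁, -a.c₂, -a.c₃⟩⟩
instance : Mul (Jet A) := ⟨fun a b => ⟨a.c₀ * b.c₀, a.c₀ * b.c₁ + a.c₁ * b.c₀,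
  a.c₀ * b.c₂ + a.c₁ * b.c₁ + a.c₂ * b.c₀,
  a.c₀ * b.c₃ + a.c₁ * b.c₂ + a.c₂ * b.c₁ + a.c₃ * b.c₀⟩⟩

@[simp] lemma zero_c₀ : (0 : Jet A).c₀ = 0 := rfl
@[simp] lemma zero_c₁ : (0 : Jet A).c₁ = 0 := rfl
@[simp] lemma zero_c₂ : (0 : Jet A).c₂ = 0 := rfl
@[simp] lemma zero_c₃ : (0 : Jet A).c₃ = 0 := rfl
@[simp] lemma one_c₀ : (1 : Jet A).c₀ = 1 := rfl
@[simp] lemma one_c₁ : (1 : Jet A).c₁ = 0 := rfl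
@[simp] lemma one_c₂ : (1 : Jet A).c₂ = 0 := rfl
@[simp] lemma one_c₃ : (1 : Jet A).c₃ = 0 := rfl
@[simp] lemma add_c₀ (a b : Jet A) : (a + b).c₀ = a.c₀ + b.c₀ := rfl
@[simp] lemma add_c₁ (a b : Jet A) : (a + b).c₁ = a.c₁ + b.c₁ := rfl
@[simp] lemma add_c₂ (a b : Jet A) : (a + b).c₂ = a.c₂ + b.c₂ := rfl
@[simp] lemma add_c₃ (a b : Jet A) : (a + b).c₃ = a.c₃ + b.c₃ := rfl
@[simp] lemma neg_c₀ (a : Jet A) : (-a).c₀ = -a.c₀ := rfl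
@[simp] lemma neg_c₁ (a : Jet A) : (-a).c₁ = -a.c₁ := rfl
@[simp] lemma neg_c₂ (a : Jet A) : (-a).c₂ = -a.c₂ := rfl
@[simp] lemma neg_c₃ (a : Jet A) : (-a).c₃ = -a.c₃ := rfl
@[simp] lemma mul_c₀ (a b : Jet A) : (a * b).c₀ = a.c₀ * b.c₀ := rfl
@[simp] lemma mul_c₁ (a b : Jet A) : (a * b).c₁ = a.c₀ * b.c₁ + a.c₁ * b.c₀ := rfl
@[simp] lemma mul_c₂ (a b : Jet A) :
    (a * b).c₂ = a.c₀ * b.c₂ + a.c₁ * b.c₁ + a.c₂ * b.c₀ := rfl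
@[simp] lemma mul_c₃ (a b : Jet A) :
    (a * b).c₃ = a.c₀ * b.c₃ + a.c₁ * b.c₂ + a.c₂ * b.c₁ + a.c₃ * b.c₀ := rfl

instance : CommRing (Jet A) where
  add_assoc a b c := by ext <;> simp [add_assoc]
  zero_add a := by ext <;> simp
  add_zero a := by ext <;> simp
  add_comm a b := by ext <;> simp [add_comm]
  neg_add_cancel a := by ext <;> simp
  left_distrib a b c := by ext <;> simp <;> ring
  right_distrib a b c := by ext <;> simp <;> ring
  zero_mul a := by ext <;> simp
  mul_zero a := by ext <;> simp
  mul_assoc a b c := by ext <;> simp <;> ring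
  one_mul a := by ext <;> simp
  mul_one a := by ext <;> simp
  mul_comm a b := by ext <;> simp <;> ring
  nsmul := nsmulRec
  zsmul := zsmulRec

@[simp] lemma sub_c₀ (a b : Jet A) : (a - b).c₀ = a.c₀ - b.c₀ := by simp [sub_eq_add_neg]
@[simp] lemma sub_c₁ (a b : Jet A) : (a - b).c₁ = a.c₁ - b.c₁ := by simp [sub_eq_add_neg]
@[simp] lemma sub_c₂ (a b : Jet A) : (a - b).c₂ = a.c₂ - b.c₂ := by simp [sub_eq_add_neg]
@[simp] lemma sub_c₃ (a b : Jet A) : (a - b).c₃ = a.c₃ - b.c₃ := by simp [sub_eq_add_neg]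

/-- The constant jets. -/
def const : A →+* Jet A where
  toFun a := ⟨a, 0, 0, 0⟩
  map_one' := rfl
  map_zero' := rfl
  map_add' a b := by ext <;> simp
  map_mul' a b := by ext <;> simp

@[simp] lemma const_c₀ (a : A) : (const a).c₀ = a := rfl
@[simp] lemma const_c₁ (a : A) : (const a).c₁ = 0 := rfl
@[simp] lemma const_c₂ (a : A) : (const a).c₂ = 0 := rfl
@[simp] lemma const_c₃ (a : A) : (const a).c₃ = 0 := rfl

/-- The constant coefficient, as a ring homomorphism. -/
def coeff₀ : Jet A →+* A where
  toFun := c₀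
  map_one' := rfl
  map_zero' := rfl
  map_add' _ _ := rfl
  map_mul' _ _ := rfl

/-- The coefficient of `t`, as an additive homomorphism. -/
def coeff₁ : Jet A →+ A where
  toFun := c₁
  map_zero' := rfl
  map_add' _ _ := rfl

/-- The coefficient of `t²`, as an additive homomorphism. -/
def coeff₂ : Jet A →+ A where
  toFun := c₂
  map_zero' := rfl
  map_add' _ _ := rfl

/-- The coefficient of `t³`, as an additive homomorphism. -/
def coeff₃ : Jet A →+ A where
  toFun := c₃
  map_zero' := rfl
  map_add' _ _ := rfl

@[simp] lemma coeff₀_apply (a : Jet A) : coeff₀ a = a.c₀ := rfl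
@[simp] lemma coeff₁_apply (a : Jet A) : coeff₁ a = a.c₁ := rfl
@[simp] lemma coeff₂_apply (a : Jet A) : coeff₂ a = a.c₂ := rfl
@[simp] lemma coeff₃_apply (a : Jet A) : coeff₃ a = a.c₃ := rfl

/-- Functoriality of `A[t]/(t⁴)`. -/
def map (f : A →+* B) : Jet A →+* Jet B where
  toFun a := ⟨f a.c₀, f a.c₁, f a.c₂, f a.c₃⟩
  map_one' := by ext <;> simp
  map_zero' := by ext <;> simp
  map_add' a b := by ext <;> simp
  map_mul' a b := by ext <;> simp

@[simp] lemma map_c₀ (f : A →+* B) (a : Jet A) : (map f a).c₀ = f a.c₀ := rfl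
@[simp] lemma map_c₁ (f : A →+* B) (a : Jet A) : (map f a).c₁ = f a.c₁ := rfl
@[simp] lemma map_c₂ (f : A →+* B) (a : Jet A) : (map f a).c₂ = f a.c₂ := rfl
@[simp] lemma map_c₃ (f : A →+* B) (a : Jet A) : (map f a).c₃ = f a.c₃ := rfl

@[simp] lemma map_const (f : A →+* B) (a : A) : map f (const a) = const (f a) := by
  ext <;> simp

lemma map_map (f : A →+* B) (g : B →+* C) (a : Jet A) : map g (map f a) = map (g.comp f) a := rfl

/-- Dividing by the constant coefficient leaves `1` minus a multiple of `t`, and `t` is nilpotent.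
This is what lets a Hasse–Schmidt derivation extend to localizations. -/
lemma isUnit_of_isUnit_c₀ {a : Jet A} (h : IsUnit a.c₀) : IsUnit a := by
  obtain ⟨v, hv⟩ := h.exists_right_inv
  have hn : (1 - const v * a) ^ 4 = 0 := by
    have h0 : (1 - const v * a).c₀ = 0 := by simp [← hv, mul_comm]
    generalize 1 - const v * a = b at h0
    rw [show b ^ 4 = (b * b) * (b * b) by ring]
    ext <;> simp [h0]
  have hu : IsUnit (const v * a) := by
    have := IsNilpotent.isUnit_one_sub (r := 1 - const v * a) ⟨4, hn⟩
    rwa [sub_sub_cancel] at this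
  exact isUnit_of_mul_isUnit_right hu

end Ring

end Jet

/-! ### Differential operators -/

section DiffOp

variable {A : Type*} [CommRing A]

lemma IsDiffOpLE.zero (n : ℕ) : IsDiffOpLE n (0 : A →+ A) := by
  induction n with
  | zero => intro a b; simp
  | succ n ih => intro a; simpa using ih

lemma IsDiffOpLE.add {n : ℕ} {D E : A →+ A} (hD : IsDiffOpLE n D) (hE : IsDiffOpLE n E) :
    IsDiffOpLE n (D + E) := by
  induction n generalizing D E with
  | zero => intro a b; simp [hD a b, hE a b, mul_add]
  | succ n ih =>
    intro a
    convert ih (hD a) (hE a) using 1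
    ext b
    simp
    ring

lemma IsDiffOpLE.mulLeft_comp {n : ℕ} {D : A →+ A} (hD : IsDiffOpLE n D) (c : A) :
    IsDiffOpLE n ((AddMonoidHom.mulLeft c).comp D) := by
  induction n generalizing D with
  | zero => intro a b; simp [hD a b]; ring
  | succ n ih =>
    intro a
    convert ih (hD a) using 1
    ext b
    simp
    ring

lemma IsDiffOpLE.succ {n : ℕ} {D : A →+ A} (hD : IsDiffOpLE n D) : IsDiffOpLE (n + 1) D := by
  induction n generalizing D with
  | zero =>
    intro a
    convert IsDiffOpLE.zero (A := A) 0
    ext b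
    simp [hD a b]
  | succ n ih => exact fun a => ih (hD a)

lemma IsDiffOpLE.mono {m n : ℕ} (h : m ≤ n) {D : A →+ A} (hD : IsDiffOpLE m D) :
    IsDiffOpLE n D := by
  induction n, h using Nat.le_induction with
  | base => exact hD
  | succ n _ ih => exact ih.succ

lemma IsDiffOpLE.mulLeft (n : ℕ) (c : A) : IsDiffOpLE n (AddMonoidHom.mulLeft c) :=
  IsDiffOpLE.mono (Nat.zero_le n) fun a b => by simp; ring

variable {Φ : A →+* Jet A} (hΦ : ∀ a, (Φ a).c₀ = a)

include hΦ

/-- Multiplicativity of `Φ` says that the commutator of the `i`-th component `Dᵢ` with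
multiplication by `a` is `∑ Dⱼ(a) Dᵢ₋ⱼ` over `1 ≤ j ≤ i`. Only lower components occur, so the order
grows by at most one at each index; the next two lemmas use the same formula. -/
lemma isDiffOpLE_coeff₁ : IsDiffOpLE 1 (Jet.coeff₁.comp Φ.toAddMonoidHom) := by
  intro a
  convert IsDiffOpLE.mulLeft 0 (Φ a).c₁
  ext b
  simp [hΦ]

lemma isDiffOpLE_coeff₂ : IsDiffOpLE 2 (Jet.coeff₂.comp Φ.toAddMonoidHom) := by
  intro a
  convert ((isDiffOpLE_coeff₁ hΦ).mulLeft_comp (Φ a).c₁).add (IsDiffOpLE.mulLeft 1 (Φ a).c₂)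
  ext b
  simp [hΦ]
  ring

lemma isDiffOpLE_coeff₃ : IsDiffOpLE 3 (Jet.coeff₃.comp Φ.toAddMonoidHom) := by
  intro a
  convert (((isDiffOpLE_coeff₂ hΦ).mulLeft_comp (Φ a).c₁).add
    ((isDiffOpLE_coeff₁ hΦ).succ.mulLeft_comp (Φ a).c₂)).add (IsDiffOpLE.mulLeft 2 (Φ a).c₃)
  ext b
  simp [hΦ]
  ring

end DiffOp

/-! ### Gluing Hasse–Schmidt derivations on a scheme -/

namespace AlgebraicGeometry.Scheme

/-- Restriction of sections, as a ring homomorphism. -/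
abbrev res (X : Scheme.{u}) {U V : X.Opens} (h : V ≤ U) : Γ(X, U) →+* Γ(X, V) :=
  (X.presheaf.map (homOfLE h).op).hom

lemma res_res (X : Scheme.{u}) {U V W : X.Opens} (h : V ≤ U) (h' : W ≤ V) (f : Γ(X, U)) :
    X.res h' (X.res h f) = X.res (h'.trans h) f := by
  rw [← CommRingCat.comp_apply, ← Functor.map_comp]
  rfl

/-- Two sections which agree on small neighbourhoods of all points are equal. -/
lemma eq_of_forall_mem (X : Scheme.{u}) {U : X.Opens} {f g : Γ(X, U)}
    (h : ∀ x ∈ U, ∃ (V : X.Opens) (hV : V ≤ U), x ∈ V ∧ X.res hV f = X.res hV g) : f = g := by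
  choose V hV hx he using h
  refine X.sheaf.eq_of_locally_eq' (fun x : U => V x.1 x.2) U (fun x => homOfLE (hV x.1 x.2)) ?_
    f g fun x => he x.1 x.2
  intro x hxU
  exact TopologicalSpace.Opens.mem_iSup.2 ⟨⟨x, hxU⟩, hx x hxU⟩

/-- A Hasse–Schmidt derivation of length `3` of the structure sheaf. -/
structure HasseSchmidt (X : Scheme.{u}) where
  /-- the action on sections -/
  toHom : ∀ U : X.Opens, Γ(X, U) →+* Jet Γ(X, U)
  c₀_toHom : ∀ U f, (toHom U f).c₀ = f
  toHom_res : ∀ (U V : X.Opens) (h : V ≤ U) (f : Γ(X, U)),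
    toHom V (X.res h f) = Jet.map (X.res h) (toHom U f)

lemma jet_ext (X : Scheme.{u}) {U : X.Opens} {a b : Jet Γ(X, U)}
    (h : ∀ x ∈ U, ∃ (V : X.Opens) (hV : V ≤ U), x ∈ V ∧
      Jet.map (X.res hV) a = Jet.map (X.res hV) b) : a = b := by
  ext
  · refine X.eq_of_forall_mem fun x hx => ?_
    obtain ⟨V, hV, hxV, e⟩ := h x hx
    exact ⟨V, hV, hxV, congrArg Jet.c₀ e⟩
  · refine X.eq_of_forall_mem fun x hx => ?_
    obtain ⟨V, hV, hxV, e⟩ := h x hx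
    exact ⟨V, hV, hxV, congrArg Jet.c₁ e⟩
  · refine X.eq_of_forall_mem fun x hx => ?_
    obtain ⟨V, hV, hxV, e⟩ := h x hx
    exact ⟨V, hV, hxV, congrArg Jet.c₂ e⟩
  · refine X.eq_of_forall_mem fun x hx => ?_
    obtain ⟨V, hV, hxV, e⟩ := h x hx
    exact ⟨V, hV, hxV, congrArg Jet.c₃ e⟩

/-- Gluing of sections over the members of a basis contained in a given open set. -/
lemma exists_section (X : Scheme.{u}) {I : Type*} (B : I → X.Opens)
    (hB : ∀ (U : X.Opens), ∀ x ∈ U, ∃ i, x ∈ B i ∧ B i ≤ U) (U : X.Opens)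
    (σ : ∀ i, B i ≤ U → Γ(X, B i))
    (hσ : ∀ i j (hi : B i ≤ U) (hj : B j ≤ U) (hij : B i ≤ B j),
      X.res hij (σ j hj) = σ i hi) :
    ∃ s : Γ(X, U), ∀ i (hi : B i ≤ U), X.res hi s = σ i hi := by
  obtain ⟨s, hs, -⟩ := X.sheaf.existsUnique_gluing'
    (fun i : {i // B i ≤ U} => B i.1) U (fun i => homOfLE i.2)
    (fun x hx => by
      obtain ⟨i, hxi, hi⟩ := hB U x hx
      exact TopologicalSpace.Opens.mem_iSup.2 ⟨⟨i, hi⟩, hxi⟩)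
    (fun i => σ i.1 i.2) (fun i j => by
      -- The intersection of two members of the basis need not be a member, so agreement on it is
      -- tested on the smaller members it contains.
      refine X.eq_of_forall_mem fun x hx => ?_
      obtain ⟨l, hxl, hl⟩ := hB _ x hx
      refine ⟨B l, hl, hxl, ?_⟩
      have hli : B l ≤ B i.1 := hl.trans inf_le_left
      have hlj : B l ≤ B j.1 := hl.trans inf_le_right
      refine (X.res_res inf_le_left hl _).trans (Eq.trans ?_ (X.res_res inf_le_right hl _).symm)
      rw [hσ l i.1 (hli.trans i.2) i.2 hli, hσ l j.1 (hlj.trans j.2) j.2 hlj])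
  exact ⟨s, fun i hi => hs ⟨i, hi⟩⟩

/-- A compatible family of Hasse–Schmidt derivations on the members of a basis extends to
the structure sheaf. -/
lemma HasseSchmidt.exists_of_basis (X : Scheme.{u}) {I : Type*} (B : I → X.Opens)
    (hB : ∀ (U : X.Opens), ∀ x ∈ U, ∃ i, x ∈ B i ∧ B i ≤ U)
    (Ψ : ∀ i, Γ(X, B i) →+* Jet Γ(X, B i)) (h₀ : ∀ i f, (Ψ i f).c₀ = f)
    (hΨ : ∀ i j (h : B i ≤ B j) f, Ψ i (X.res h f) = Jet.map (X.res h) (Ψ j f)) :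
    ∃ D : X.HasseSchmidt, ∀ i, D.toHom (B i) = Ψ i := by
  have key (U : X.Opens) (f : Γ(X, U)) : ∃ s : Jet Γ(X, U),
      ∀ i (hi : B i ≤ U), Jet.map (X.res hi) s = Ψ i (X.res hi f) := by
    have compat (i j) (hi : B i ≤ U) (hj : B j ≤ U) (hij : B i ≤ B j) :
        Jet.map (X.res hij) (Ψ j (X.res hj f)) = Ψ i (X.res hi f) := by
      rw [← hΨ, res_res]
    -- Only three components have to be glued: the constant one is `f` itself.
    obtain ⟨s₁, h₁⟩ := X.exists_section B hB U (fun i hi => (Ψ i (X.res hi f)).c₁)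
      fun i j hi hj hij => congrArg Jet.c₁ (compat i j hi hj hij)
    obtain ⟨s₂, h₂⟩ := X.exists_section B hB U (fun i hi => (Ψ i (X.res hi f)).c₂)
      fun i j hi hj hij => congrArg Jet.c₂ (compat i j hi hj hij)
    obtain ⟨s₃, h₃⟩ := X.exists_section B hB U (fun i hi => (Ψ i (X.res hi f)).c₃)
      fun i j hi hj hij => congrArg Jet.c₃ (compat i j hi hj hij)
    exact ⟨⟨f, s₁, s₂, s₃⟩, fun i hi => Jet.ext (h₀ _ _).symm (h₁ i hi) (h₂ i hi) (h₃ i hi)⟩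
  choose T hT using key
  -- Jets are determined by their restrictions to the basis. All ring homomorphism laws for `T U`
  -- follow from those of the `Ψ i`.
  have uniq {U : X.Opens} {a b : Jet Γ(X, U)}
      (h : ∀ i (hi : B i ≤ U), Jet.map (X.res hi) a = Jet.map (X.res hi) b) : a = b :=
    X.jet_ext fun x hx => by
      obtain ⟨i, hxi, hi⟩ := hB U x hx
      exact ⟨B i, hi, hxi, h i hi⟩
  let T' (U : X.Opens) : Γ(X, U) →+* Jet Γ(X, U) :=
    { toFun := T U
      map_one' := uniq fun i hi => by simp only [hT, map_one]
      map_zero' := uniq fun i hi => by simp only [hT, map_zero]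
      map_add' := fun a b => uniq fun i hi => by simp only [hT, map_add]
      map_mul' := fun a b => uniq fun i hi => by simp only [hT, map_mul] }
  refine ⟨⟨T', fun U f => ?_, fun U V h f => ?_⟩, fun i => ?_⟩
  · refine X.eq_of_forall_mem fun x hx => ?_
    obtain ⟨i, hxi, hi⟩ := hB U x hx
    exact ⟨B i, hi, hxi, (congrArg Jet.c₀ (hT U f i hi)).trans (h₀ _ _)⟩
  · refine uniq fun i hi => ?_
    refine (hT V (X.res h f) i hi).trans ?_
    rw [res_res, ← hT U f i (hi.trans h), Jet.map_map]
    congr 2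
    ext g
    exact (X.res_res h hi g).symm
  · ext1 f
    refine uniq fun j hj => ?_
    exact (hT (B i) f j hj).trans (hΨ j i hj f)

/-- Hasse–Schmidt derivations on the members of an affine open covering extend to the
structure sheaf if they agree on the overlaps. -/
theorem HasseSchmidt.exists_of_affineCover (X : Scheme.{u}) {S : Type*} (U : S → X.Opens)
    (hU : ∀ s, IsAffineOpen (U s)) (hcov : ∀ x, ∃ s, x ∈ U s)
    (Φ : ∀ s, Γ(X, U s) →+* Jet Γ(X, U s)) (h₀ : ∀ s f, (Φ s f).c₀ = f)
    (compat : ∀ s t (V : X.Opens) (hs : V ≤ U s) (ht : V ≤ U t) (Ψ : Γ(X, V) →+* Jet Γ(X, V)),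
      (∀ f, Ψ (X.res hs f) = Jet.map (X.res hs) (Φ s f)) →
      ∀ f, Ψ (X.res ht f) = Jet.map (X.res ht) (Φ t f)) :
    ∃ D : X.HasseSchmidt, ∀ s, D.toHom (U s) = Φ s := by
  -- The basis consists of the principal open subsets of the members of the covering; on each of
  -- them the derivation is forced by the universal property of localization.
  let B : (Σ s, Γ(X, U s)) → X.Opens := fun i => X.basicOpen i.2
  have hBU (i : Σ s, Γ(X, U s)) : B i ≤ U i.1 := X.basicOpen_le i.2
  let alg (i : Σ s, Γ(X, U s)) : Algebra Γ(X, U i.1) Γ(X, B i) := (X.res (hBU i)).toAlgebra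
  have loc (i : Σ s, Γ(X, U s)) : IsLocalization.Away i.2 Γ(X, B i) :=
    (hU i.1).isLocalization_basicOpen i.2
  have unit (i : Σ s, Γ(X, U s)) :
      IsUnit (((Jet.map (X.res (hBU i))).comp (Φ i.1)) i.2) := by
    refine Jet.isUnit_of_isUnit_c₀ ?_
    simp only [RingHom.comp_apply, Jet.map_c₀, h₀]
    exact IsLocalization.Away.algebraMap_isUnit (S := Γ(X, B i)) i.2
  let Ψ (i : Σ s, Γ(X, U s)) : Γ(X, B i) →+* Jet Γ(X, B i) :=
    IsLocalization.Away.lift i.2 (unit i)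
  have hΨ (i : Σ s, Γ(X, U s)) (f : Γ(X, U i.1)) :
      Ψ i (X.res (hBU i) f) = Jet.map (X.res (hBU i)) (Φ i.1 f) :=
    IsLocalization.Away.lift_eq i.2 (unit i) f
  have hext (i : Σ s, Γ(X, U s)) {C : Type u} [CommRing C] (α β : Γ(X, B i) →+* C)
      (h : ∀ f, α (X.res (hBU i) f) = β (X.res (hBU i) f)) : α = β :=
    IsLocalization.ringHom_ext (Submonoid.powers i.2) (RingHom.ext h)
  obtain ⟨D, hD⟩ := HasseSchmidt.exists_of_basis X B
    (fun V x hx => by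
      obtain ⟨s, hs⟩ := hcov x
      obtain ⟨f, hf, hxf⟩ := (hU s).exists_basicOpen_le ⟨x, hx⟩ hs
      exact ⟨⟨s, f⟩, hxf, hf⟩)
    Ψ (fun i f => RingHom.congr_fun (hext i (Jet.coeff₀.comp (Ψ i)) (RingHom.id _) fun f => by
        change (Ψ i (X.res (hBU i) f)).c₀ = _
        rw [hΨ, Jet.map_c₀, h₀]
        rfl) f)
    (fun i j h f => RingHom.congr_fun (hext j ((Ψ i).comp (X.res h))
        ((Jet.map (X.res h)).comp (Ψ j)) fun f => by
        change Ψ i (X.res h (X.res (hBU j) f)) = Jet.map (X.res h) (Ψ j (X.res (hBU j) f))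
        -- `B i` and `B j` may come from different members of the covering. As `B i` lies in both,
        -- `compat` turns the fact that `Ψ i` extends `Φ i.1` into the fact that it extends `Φ j.1`.
        rw [hΨ, res_res, compat i.1 j.1 (B i) (hBU i) (h.trans (hBU j)) (Ψ i) (hΨ i), Jet.map_map]
        congr 2
        ext g
        exact (X.res_res (hBU j) h g).symm) f)
  refine ⟨D, fun s => RingHom.ext fun f => X.jet_ext fun x hx => ?_⟩
  obtain ⟨g, hg, hxg⟩ := (hU s).exists_basicOpen_le ⟨x, hx⟩ hx
  refine ⟨B ⟨s, g⟩, hg, hxg, ?_⟩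
  rw [← D.toHom_res, hD]
  exact hΨ ⟨s, g⟩ f

end AlgebraicGeometry.Scheme

/-! ### The expansion of functions along the formal group

Translation by the point with parameter `z = t` is the ring homomorphism `exp (log(t) P)`, where
`log(t) = t + a₁ t² / 2 + (a₁² + a₂) t³ / 3 + ⋯`. Modulo `t⁴` it is
`1 + P t + (P² + a₁ P) / 2 t² + (P³ + 3 a₁ P² + 2 (a₁² + a₂) P) / 6 t³`, and it has integral
coefficients. -/

noncomputable section

namespace WeierstrassCurve

section Formulas

variable {B : Type*} [CommRing B] (W : WeierstrassCurve B)

/-- The expansion of the coordinate `z`. -/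
def jetZ (z w : B) : Jet B where
  c₀ :=
    z
  c₁ :=
    -W.a₁ * z - W.a₂ * z ^ 2 - 2 * W.a₃ * w - 2 * W.a₄ * z * w - 3 * W.a₆ * w ^ 2 + 1
  c₂ :=
    W.a₁ * W.a₂ * z ^ 2 - W.a₁ * W.a₃ * w - 3 * W.a₁ * W.a₆ * w ^ 2 + W.a₂ ^ 2 * z ^ 3
    + W.a₂ * W.a₄ * z ^ 2 * w - 3 * W.a₂ * W.a₆ * z * w ^ 2 - W.a₂ * z + W.a₃ * W.a₄ * w ^ 2
    - 3 * W.a₃ * z ^ 2 + W.a₄ ^ 2 * z * w ^ 2 - 3 * W.a₄ * z ^ 3 - W.a₄ * w - 9 * W.a₆ * z ^ 2 * w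
  c₃ :=
    -W.a₁ ^ 2 * W.a₃ * w - 4 * W.a₁ ^ 2 * W.a₆ * w ^ 2 - W.a₁ * W.a₂ ^ 2 * z ^ 3
    - 2 * W.a₁ * W.a₂ * W.a₃ * z * w - W.a₁ * W.a₂ * W.a₄ * z ^ 2 * w
    - 9 * W.a₁ * W.a₂ * W.a₆ * z * w ^ 2 + W.a₁ * W.a₃ * W.a₄ * w ^ 2 - W.a₁ * W.a₃ * z ^ 2
    + W.a₁ * W.a₄ ^ 2 * z * w ^ 2 - 2 * W.a₁ * W.a₄ * W.a₆ * w ^ 3 + W.a₁ * W.a₄ * z ^ 3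
    - W.a₁ * W.a₄ * w - 9 * W.a₁ * W.a₆ * z ^ 2 * w - W.a₂ ^ 3 * z ^ 4
    - 2 * W.a₂ ^ 2 * W.a₃ * z ^ 2 * w - 2 * W.a₂ ^ 2 * W.a₄ * z ^ 3 * w
    - 6 * W.a₂ ^ 2 * W.a₆ * z ^ 2 * w ^ 2 + W.a₂ ^ 2 * z ^ 2 + 2 * W.a₂ * W.a₃ * W.a₆ * w ^ 3
    + 2 * W.a₂ * W.a₃ * z ^ 3 - 2 * W.a₂ * W.a₄ * W.a₆ * z * w ^ 3 + 4 * W.a₂ * W.a₄ * z ^ 4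
    + 3 * W.a₂ * W.a₆ ^ 2 * w ^ 4 - 6 * W.a₂ * W.a₆ * z ^ 3 * w - W.a₂ * W.a₆ * w ^ 2
    + 4 * W.a₃ ^ 2 * z * w + 12 * W.a₃ * W.a₄ * z ^ 2 * w + 18 * W.a₃ * W.a₆ * z * w ^ 2
    - 2 * W.a₃ * z - W.a₄ ^ 2 * W.a₆ * w ^ 4 + 8 * W.a₄ ^ 2 * z ^ 3 * w
    + 18 * W.a₄ * W.a₆ * z ^ 2 * w ^ 2 - 4 * W.a₄ * z ^ 2 + 18 * W.a₆ ^ 2 * z * w ^ 3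
    - 9 * W.a₆ * z ^ 4 - 6 * W.a₆ * z * w

/-- The expansion of the coordinate `w`. -/
def jetW (z w : B) : Jet B where
  c₀ :=
    w
  c₁ :=
    W.a₁ * w + 2 * W.a₂ * z * w + W.a₄ * w ^ 2 + 3 * z ^ 2
  c₂ :=
    W.a₁ ^ 2 * w + 2 * W.a₁ * W.a₂ * z * w + 2 * W.a₁ * W.a₄ * w ^ 2 + W.a₂ ^ 2 * z ^ 2 * w
    - 2 * W.a₂ * W.a₃ * w ^ 2 + W.a₂ * W.a₄ * z * w ^ 2 - 3 * W.a₂ * W.a₆ * w ^ 3 + W.a₂ * w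
    - 6 * W.a₃ * z * w + W.a₄ ^ 2 * w ^ 3 - 3 * W.a₄ * z ^ 2 * w - 9 * W.a₆ * z * w ^ 2 + 3 * z
  c₃ :=
    W.a₁ ^ 3 * w + 2 * W.a₁ ^ 2 * W.a₂ * z * w + 3 * W.a₁ ^ 2 * W.a₄ * w ^ 2 + W.a₁ ^ 2 * z ^ 2
    + W.a₁ * W.a₂ ^ 2 * z ^ 2 * w - 4 * W.a₁ * W.a₂ * W.a₃ * w ^ 2
    + 3 * W.a₁ * W.a₂ * W.a₄ * z * w ^ 2 - 7 * W.a₁ * W.a₂ * W.a₆ * w ^ 3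
    + 2 * W.a₁ * W.a₂ * z ^ 3 + 2 * W.a₁ * W.a₂ * w - 4 * W.a₁ * W.a₃ * z * w
    + 3 * W.a₁ * W.a₄ ^ 2 * w ^ 3 + 3 * W.a₁ * W.a₄ * z ^ 2 * w - 9 * W.a₁ * W.a₆ * z * w ^ 2
    + W.a₁ * z - 4 * W.a₂ ^ 2 * W.a₃ * z * w ^ 2 - 8 * W.a₂ ^ 2 * W.a₆ * z * w ^ 3
    + W.a₂ ^ 2 * z ^ 4 + 2 * W.a₂ ^ 2 * z * w - 2 * W.a₂ * W.a₃ * W.a₄ * w ^ 3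
    - 6 * W.a₂ * W.a₃ * z ^ 2 * w + 2 * W.a₂ * W.a₄ ^ 2 * z * w ^ 3
    - 4 * W.a₂ * W.a₄ * W.a₆ * w ^ 4 + 2 * W.a₂ * W.a₄ * z ^ 3 * w + W.a₂ * W.a₄ * w ^ 2
    - 18 * W.a₂ * W.a₆ * z ^ 2 * w ^ 2 + W.a₂ * z ^ 2 + 4 * W.a₃ ^ 2 * w ^ 2
    + 6 * W.a₃ * W.a₄ * z * w ^ 2 + 12 * W.a₃ * W.a₆ * w ^ 3 - 6 * W.a₃ * z ^ 3 - 4 * W.a₃ * w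
    + W.a₄ ^ 3 * w ^ 4 + 6 * W.a₄ ^ 2 * z ^ 2 * w ^ 2 + 6 * W.a₄ * W.a₆ * z * w ^ 3
    - 3 * W.a₄ * z ^ 4 - 4 * W.a₄ * z * w + 9 * W.a₆ ^ 2 * w ^ 4 - 18 * W.a₆ * z ^ 3 * w
    - 6 * W.a₆ * w ^ 2 + 1

/-- The expansion of the coordinate `x`. -/
def jetX (x y : B) : Jet B where
  c₀ :=
    x
  c₁ :=
    W.a₁ * x + W.a₃ + 2 * y
  c₂ :=
    W.a₁ ^ 2 * x + W.a₁ * W.a₃ + W.a₁ * y + 2 * W.a₂ * x + W.a₄ + 3 * x ^ 2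
  c₃ :=
    W.a₁ ^ 3 * x + W.a₁ ^ 2 * W.a₃ + W.a₁ ^ 2 * y + 3 * W.a₁ * W.a₂ * x + W.a₁ * W.a₄
    + 5 * W.a₁ * x ^ 2 + W.a₂ * W.a₃ + 2 * W.a₂ * y + 2 * W.a₃ * x + 4 * x * y

/-- The expansion of the coordinate `y`. -/
def jetY (x y : B) : Jet B where
  c₀ :=
    y
  c₁ :=
    -W.a₁ * y + 2 * W.a₂ * x + W.a₄ + 3 * x ^ 2
  c₂ :=
    W.a₁ * W.a₂ * x + 3 * W.a₁ * x ^ 2 + W.a₂ * W.a₃ + 2 * W.a₂ * y + 3 * W.a₃ * x + 6 * x * y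
  c₃ :=
    W.a₁ ^ 2 * W.a₂ * x + 4 * W.a₁ ^ 2 * x ^ 2 + W.a₁ * W.a₂ * W.a₃ + W.a₁ * W.a₂ * y
    + 5 * W.a₁ * W.a₃ * x + 8 * W.a₁ * x * y + 2 * W.a₂ ^ 2 * x + W.a₂ * W.a₄ + 7 * W.a₂ * x ^ 2
    + W.a₃ ^ 2 + 4 * W.a₃ * y + 2 * W.a₄ * x + 6 * x ^ 3 + 4 * y ^ 2

open Jet in
-- The components are normalized so that this is an identity for all `z` and `w` of the plane, not
-- only on the curve. Its `t`-coefficient is the vanishing of `planeField` on the equation. The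
-- expansion thus descends to the quotient at once.
lemma equation_jetZ_jetW (z w : B) :
    W.jetW z w - const W.a₁ * W.jetZ z w * W.jetW z w - const W.a₃ * W.jetW z w ^ 2
      - (W.jetZ z w ^ 3 + const W.a₂ * W.jetZ z w ^ 2 * W.jetW z w
        + const W.a₄ * W.jetZ z w * W.jetW z w ^ 2 + const W.a₆ * W.jetW z w ^ 3) =
    const (w - W.a₁ * z * w - W.a₃ * w ^ 2
      - (z ^ 3 + W.a₂ * z ^ 2 * w + W.a₄ * z * w ^ 2 + W.a₆ * w ^ 3)) := by
  simp only [pow_succ, pow_zero, one_mul]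
  ext <;> simp [jetZ, jetW] <;> ring

open Jet in
lemma equation_jetX_jetY (x y : B) :
    W.jetY x y ^ 2 + const W.a₁ * W.jetX x y * W.jetY x y + const W.a₃ * W.jetY x y
      - (W.jetX x y ^ 3 + const W.a₂ * W.jetX x y ^ 2 + const W.a₄ * W.jetX x y + const W.a₆) =
    const (y ^ 2 + W.a₁ * x * y + W.a₃ * y - (x ^ 3 + W.a₂ * x ^ 2 + W.a₄ * x + W.a₆)) := by
  simp only [pow_succ, pow_zero, one_mul]
  ext <;> simp [jetX, jetY] <;> ring

variable {W} {x y w : B}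
  (h : y ^ 2 + W.a₁ * x * y + W.a₃ * y - (x ^ 3 + W.a₂ * x ^ 2 + W.a₄ * x + W.a₆) = 0)
  (hy : y * w + 1 = 0)

include h hy

/-- The relation `y w = -1` persists after translation. Unlike the chart equations, this holds only
on the curve: each component lies in the ideal generated by the curve equation `h` and by `hy`, and
the coefficients below are the cofactors. -/
lemma jetY_mul_jetW : W.jetY x y * W.jetW (x * w) w = -1 := by
  ext <;> simp only [jetW, jetY, Jet.mul_c₀, Jet.mul_c₁, Jet.mul_c₂, Jet.mul_c₃, Jet.neg_c₀,
    Jet.neg_c₁, Jet.neg_c₂, Jet.neg_c₃, Jet.one_c₀, Jet.one_c₁, Jet.one_c₂, Jet.one_c₃]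
  · linear_combination hy
  · linear_combination
      (2 * W.a₂ * w * x + W.a₄ * w + 3 * w * x ^ 2) * hy
  · linear_combination
      (-3 * W.a₂ * w ^ 2 - 9 * w ^ 2 * x) * h
      + (3 * W.a₁ * W.a₂ * w * x + W.a₁ * W.a₄ * w + 6 * W.a₁ * w * x ^ 2 + W.a₂ ^ 2 * w ^ 2 * x ^ 2
      + W.a₂ * W.a₃ * w + W.a₂ * W.a₄ * w ^ 2 * x - 3 * W.a₂ * W.a₆ * w ^ 2 + 3 * W.a₂ * w * y
      + 3 * W.a₃ * w * x + W.a₄ ^ 2 * w ^ 2 - 3 * W.a₄ * w ^ 2 * x ^ 2 - 9 * W.a₆ * w ^ 2 * x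
      + 9 * w * x * y) * hy
  · linear_combination
      (-4 * W.a₁ * W.a₂ * w ^ 2 - 9 * W.a₁ * w ^ 2 * x - 2 * W.a₂ ^ 2 * w ^ 3 * x
      - W.a₂ * W.a₄ * w ^ 3 + 3 * W.a₃ * w ^ 2 + 6 * W.a₄ * w ^ 3 * x + 9 * W.a₆ * w ^ 3 + 3 * w) * h
      + (4 * W.a₁ ^ 2 * W.a₂ * w * x + W.a₁ ^ 2 * W.a₄ * w + 10 * W.a₁ ^ 2 * w * x ^ 2
      + 2 * W.a₁ * W.a₂ ^ 2 * w ^ 2 * x ^ 2 + 2 * W.a₁ * W.a₂ * W.a₃ * w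
      + 3 * W.a₁ * W.a₂ * W.a₄ * w ^ 2 * x - 4 * W.a₁ * W.a₂ * W.a₆ * w ^ 2
      + 2 * W.a₁ * W.a₂ * w ^ 2 * x ^ 3 + 4 * W.a₁ * W.a₂ * w * y + 8 * W.a₁ * W.a₃ * w * x
      + 2 * W.a₁ * W.a₄ ^ 2 * w ^ 2 - 9 * W.a₁ * W.a₆ * w ^ 2 * x + 9 * W.a₁ * w * x * y
      - 2 * W.a₂ ^ 2 * W.a₃ * w ^ 2 * x - 8 * W.a₂ ^ 2 * W.a₆ * w ^ 3 * x
      + W.a₂ ^ 2 * w ^ 3 * x ^ 4 + 2 * W.a₂ ^ 2 * w ^ 2 * x * y + 4 * W.a₂ ^ 2 * w * x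
      - W.a₂ * W.a₃ * W.a₄ * w ^ 2 - 6 * W.a₂ * W.a₃ * w ^ 2 * x ^ 2
      + 2 * W.a₂ * W.a₄ ^ 2 * w ^ 3 * x - 4 * W.a₂ * W.a₄ * W.a₆ * w ^ 3
      + 2 * W.a₂ * W.a₄ * w ^ 3 * x ^ 3 + W.a₂ * W.a₄ * w ^ 2 * y + 2 * W.a₂ * W.a₄ * w
      - 18 * W.a₂ * W.a₆ * w ^ 3 * x ^ 2 + 19 * W.a₂ * w * x ^ 2 + W.a₃ ^ 2 * w
      + 3 * W.a₃ * W.a₆ * w ^ 2 - 6 * W.a₃ * w ^ 2 * x ^ 3 - 3 * W.a₃ * w * y + W.a₄ ^ 3 * w ^ 3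
      + 6 * W.a₄ ^ 2 * w ^ 3 * x ^ 2 + 6 * W.a₄ * W.a₆ * w ^ 3 * x - 3 * W.a₄ * w ^ 3 * x ^ 4
      - 6 * W.a₄ * w ^ 2 * x * y + 8 * W.a₄ * w * x + 9 * W.a₆ ^ 2 * w ^ 3
      - 18 * W.a₆ * w ^ 3 * x ^ 3 - 9 * W.a₆ * w ^ 2 * y + 3 * W.a₆ * w + 18 * w * x ^ 3 + y) * hy

lemma jetX_mul_jetW : W.jetX x y * W.jetW (x * w) w = W.jetZ (x * w) w := by
  ext <;> simp only [jetW, jetX, jetZ, Jet.mul_c₀, Jet.mul_c₁, Jet.mul_c₂, Jet.mul_c₃]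
  -- The constant component reads `x * w = x * w` and is already closed; three components remain.
  · linear_combination
      (-3 * w ^ 2) * h
      + (3 * W.a₁ * w * x + 3 * W.a₃ * w + 3 * w * y - 1) * hy
  · linear_combination
      (-3 * W.a₁ * w ^ 2) * h
      + (3 * W.a₁ ^ 2 * w * x + 3 * W.a₁ * W.a₃ * w + 3 * W.a₁ * w * y + 4 * W.a₂ * w * x
      + 2 * W.a₄ * w + 6 * w * x ^ 2) * hy
  · linear_combination
      (-4 * W.a₁ ^ 2 * w ^ 2 - 2 * W.a₁ * W.a₂ * w ^ 3 * x - 2 * W.a₁ * W.a₄ * w ^ 3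
      - W.a₂ ^ 2 * w ^ 4 * x ^ 2 + 2 * W.a₂ * W.a₃ * w ^ 3 - W.a₂ * W.a₄ * w ^ 4 * x
      + 3 * W.a₂ * W.a₆ * w ^ 4 - 4 * W.a₂ * w ^ 2 + 6 * W.a₃ * w ^ 3 * x - W.a₄ ^ 2 * w ^ 4
      + 3 * W.a₄ * w ^ 4 * x ^ 2 + 9 * W.a₆ * w ^ 4 * x - 9 * w ^ 2 * x) * h
      + (4 * W.a₁ ^ 3 * w * x + 2 * W.a₁ ^ 2 * W.a₂ * w ^ 2 * x ^ 2 + 4 * W.a₁ ^ 2 * W.a₃ * w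
      + 2 * W.a₁ ^ 2 * W.a₄ * w ^ 2 * x + 4 * W.a₁ ^ 2 * w * y + W.a₁ * W.a₂ ^ 2 * w ^ 3 * x ^ 3
      + W.a₁ * W.a₂ * W.a₄ * w ^ 3 * x ^ 2 - 3 * W.a₁ * W.a₂ * W.a₆ * w ^ 3 * x
      + 2 * W.a₁ * W.a₂ * w ^ 2 * x * y + 8 * W.a₁ * W.a₂ * w * x + 2 * W.a₁ * W.a₃ * W.a₄ * w ^ 2
      - 6 * W.a₁ * W.a₃ * w ^ 2 * x ^ 2 + W.a₁ * W.a₄ ^ 2 * w ^ 3 * x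
      - 3 * W.a₁ * W.a₄ * w ^ 3 * x ^ 3 + 2 * W.a₁ * W.a₄ * w ^ 2 * y + 3 * W.a₁ * W.a₄ * w
      - 9 * W.a₁ * W.a₆ * w ^ 3 * x ^ 2 + 12 * W.a₁ * w * x ^ 2 + W.a₂ ^ 2 * W.a₃ * w ^ 3 * x ^ 2
      + W.a₂ ^ 2 * w ^ 3 * x ^ 2 * y + W.a₂ ^ 2 * w ^ 2 * x ^ 2 - 2 * W.a₂ * W.a₃ ^ 2 * w ^ 2
      + W.a₂ * W.a₃ * W.a₄ * w ^ 3 * x - 3 * W.a₂ * W.a₃ * W.a₆ * w ^ 3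
      - 2 * W.a₂ * W.a₃ * w ^ 2 * y + 2 * W.a₂ * W.a₃ * w + W.a₂ * W.a₄ * w ^ 3 * x * y
      + W.a₂ * W.a₄ * w ^ 2 * x - 3 * W.a₂ * W.a₆ * w ^ 3 * y - 3 * W.a₂ * W.a₆ * w ^ 2
      + 4 * W.a₂ * w * y - 6 * W.a₃ ^ 2 * w ^ 2 * x + W.a₃ * W.a₄ ^ 2 * w ^ 3
      - 3 * W.a₃ * W.a₄ * w ^ 3 * x ^ 2 - 9 * W.a₃ * W.a₆ * w ^ 3 * x - 6 * W.a₃ * w ^ 2 * x * y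
      + 3 * W.a₃ * w * x + W.a₄ ^ 2 * w ^ 3 * y + W.a₄ ^ 2 * w ^ 2 - 3 * W.a₄ * w ^ 3 * x ^ 2 * y
      - 3 * W.a₄ * w ^ 2 * x ^ 2 - 9 * W.a₆ * w ^ 3 * x * y - 9 * W.a₆ * w ^ 2 * x + 9 * w * x * y
      + x) * hy

end Formulas

/-! ### The Hasse–Schmidt derivations on the two charts -/

variable {R : Type u} [CommRing R] (W : WeierstrassCurve R)

lemma chartO_hom_ext {C : Type*} [Semiring C] {f g : W.ChartO →+* C}
    (hr : ∀ r : R, f (algebraMap R _ r) = g (algebraMap R _ r))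
    (hz : f W.zO = g W.zO) (hw : f W.wO = g W.wO) : f = g := by
  refine Ideal.Quotient.ringHom_ext (MvPolynomial.ringHom_ext hr fun i => ?_)
  fin_cases i
  exacts [hz, hw]

lemma coordinateRing_hom_ext {C : Type*} [Semiring C] {f g : W.toAffine.CoordinateRing →+* C}
    (hr : ∀ r : R, f (algebraMap R _ r) = g (algebraMap R _ r))
    (hx : f W.xA = g W.xA) (hy : f W.yA = g W.yA) : f = g := by
  refine AdjoinRoot.ringHom_ext (Polynomial.ringHom_ext (fun r => ?_) hx) hy
  have e : AdjoinRoot.of W.toAffine.polynomial (Polynomial.C r) =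
      algebraMap R W.toAffine.CoordinateRing r := by
    rw [IsScalarTower.algebraMap_apply R (Polynomial R) W.toAffine.CoordinateRing]
    simp
  simpa only [RingHom.comp_apply, e] using hr r

/-- The Weierstrass equation `W` over the ring `W.ChartO`. -/
abbrev baseO : WeierstrassCurve W.ChartO := W.map (algebraMap R W.ChartO)

/-- The Weierstrass equation `W` over the ring of functions on the chart `{Z ≠ 0}`. -/
abbrev baseA : WeierstrassCurve W.toAffine.CoordinateRing :=
  W.map (algebraMap R W.toAffine.CoordinateRing)

/-- The expansion of functions on the chart `{Y ≠ 0}`. -/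
def jetO : W.ChartO →+* Jet W.ChartO :=
  Ideal.Quotient.lift _ (MvPolynomial.eval₂Hom (Jet.const.comp (algebraMap R W.ChartO))
    ![W.baseO.jetZ W.zO W.wO, W.baseO.jetW W.zO W.wO]) (by
      intro a ha
      obtain ⟨g, rfl⟩ := Ideal.mem_span_singleton.1 ha
      rw [map_mul]
      convert zero_mul _
      have h := W.baseO.equation_jetZ_jetW W.zO W.wO
      simp only [map_a₁, map_a₂, map_a₃, map_a₄, map_a₆] at h
      rw [W.eqO_eq_zero, map_zero] at h
      simpa [eqO] using h)

lemma jetO_algebraMap (r : R) : W.jetO (algebraMap R _ r) = Jet.const (algebraMap R _ r) :=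
  (Ideal.Quotient.lift_mk _ _ _).trans (by simp)

lemma jetO_zO : W.jetO W.zO = W.baseO.jetZ W.zO W.wO :=
  (Ideal.Quotient.lift_mk _ _ _).trans (by simp)

lemma jetO_wO : W.jetO W.wO = W.baseO.jetW W.zO W.wO :=
  (Ideal.Quotient.lift_mk _ _ _).trans (by simp)

lemma jetO_c₀ (f : W.ChartO) : (W.jetO f).c₀ = f := by
  suffices h : Jet.coeff₀.comp W.jetO = RingHom.id _ from RingHom.congr_fun h f
  refine W.chartO_hom_ext (fun r => ?_) ?_ ?_ <;>
    simp only [RingHom.comp_apply, jetO_algebraMap, jetO_zO, jetO_wO] <;> rfl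

/-- The expansion of functions on the chart `{Z ≠ 0}`. -/
def jetA : W.toAffine.CoordinateRing →+* Jet W.toAffine.CoordinateRing :=
  AdjoinRoot.lift
    (Polynomial.eval₂RingHom (Jet.const.comp (algebraMap R W.toAffine.CoordinateRing))
      (W.baseA.jetX W.xA W.yA)) (W.baseA.jetY W.xA W.yA) (by
      have h := W.baseA.equation_jetX_jetY W.xA W.yA
      simp only [map_a₁, map_a₂, map_a₃, map_a₄, map_a₆] at h
      rw [W.eqA, sub_self, map_zero] at h
      simp only [Affine.polynomial, Polynomial.eval₂_add, Polynomial.eval₂_sub,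
        Polynomial.eval₂_mul, Polynomial.eval₂_pow, Polynomial.eval₂_X, Polynomial.eval₂_C,
        Polynomial.coe_eval₂RingHom, RingHom.comp_apply]
      linear_combination h)

lemma jetA_algebraMap (r : R) : W.jetA (algebraMap R _ r) = Jet.const (algebraMap R _ r) := by
  have e : algebraMap R W.toAffine.CoordinateRing r =
      AdjoinRoot.of W.toAffine.polynomial (Polynomial.C r) := by
    rw [IsScalarTower.algebraMap_apply R (Polynomial R) W.toAffine.CoordinateRing]
    simp
  conv_lhs => rw [e]
  refine (AdjoinRoot.lift_of _).trans ?_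
  simp

lemma jetA_xA : W.jetA W.xA = W.baseA.jetX W.xA W.yA := by
  refine (AdjoinRoot.lift_of _).trans ?_
  simp

lemma jetA_yA : W.jetA W.yA = W.baseA.jetY W.xA W.yA :=
  AdjoinRoot.lift_root _

lemma jetA_c₀ (f : W.toAffine.CoordinateRing) : (W.jetA f).c₀ = f := by
  suffices h : Jet.coeff₀.comp W.jetA = RingHom.id _ from RingHom.congr_fun h f
  refine W.coordinateRing_hom_ext (fun r => ?_) ?_ ?_ <;>
    simp only [RingHom.comp_apply, jetA_algebraMap, jetA_xA, jetA_yA] <;> rfl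

/-! ### Naturality of the expansions under ring homomorphisms -/

lemma map_jetZ {B C : Type*} [CommRing B] [CommRing C] (V : WeierstrassCurve B) (f : B →+* C)
    (z w : B) : Jet.map f (V.jetZ z w) = (V.map f).jetZ (f z) (f w) := by
  ext <;> simp [jetZ, map_ofNat f]

lemma map_jetW {B C : Type*} [CommRing B] [CommRing C] (V : WeierstrassCurve B) (f : B →+* C)
    (z w : B) : Jet.map f (V.jetW z w) = (V.map f).jetW (f z) (f w) := by
  ext <;> simp [jetW, map_ofNat f]

lemma map_jetX {B C : Type*} [CommRing B] [CommRing C] (V : WeierstrassCurve B) (f : B →+* C)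
    (x y : B) : Jet.map f (V.jetX x y) = (V.map f).jetX (f x) (f y) := by
  ext <;> simp [jetX, map_ofNat f]

lemma map_jetY {B C : Type*} [CommRing B] [CommRing C] (V : WeierstrassCurve B) (f : B →+* C)
    (x y : B) : Jet.map f (V.jetY x y) = (V.map f).jetY (f x) (f y) := by
  ext <;> simp [jetY, map_ofNat f]

section Reduction

variable {k : Type u} [CommRing k] {V : WeierstrassCurve R} {W' : WeierstrassCurve k}
  (φ : R →+* k) (h : V.map φ = W')

lemma chartRed_algebraMap (r : R) :
    chartRed φ h (algebraMap R _ r) = algebraMap k _ (φ r) :=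
  (Ideal.quotientMap_mk ..).trans (by simp; rfl)

lemma chartRed_zO : chartRed φ h V.zO = W'.zO :=
  (Ideal.quotientMap_mk ..).trans (by simp)

lemma chartRed_wO : chartRed φ h V.wO = W'.wO :=
  (Ideal.quotientMap_mk ..).trans (by simp)

/-- The expansions of `z` and `w` are polynomials with integer coefficients in `z`, `w` and the
`aᵢ`, so they commute with any change of base. This is why the operators over `k` are the reductions
of those of every lift. -/
lemma jetO_chartRed (f : V.ChartO) :
    W'.jetO (chartRed φ h f) = Jet.map (chartRed φ h) (V.jetO f) := by
  suffices e : W'.jetO.comp (chartRed φ h) = (Jet.map (chartRed φ h)).comp V.jetO from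
    RingHom.congr_fun e f
  have hb : V.baseO.map (chartRed φ h) = W'.baseO := by
    subst h
    ext <;> exact chartRed_algebraMap φ rfl _
  refine V.chartO_hom_ext (fun r => ?_) ?_ ?_
  · simp only [RingHom.comp_apply, jetO_algebraMap, chartRed_algebraMap, Jet.map_const]
  · simp only [RingHom.comp_apply, jetO_zO, chartRed_zO, chartRed_wO, map_jetZ, hb]
  · simp only [RingHom.comp_apply, jetO_wO, chartRed_zO, chartRed_wO, map_jetW, hb]

lemma chartRed_surjective (hφ : Function.Surjective φ) : Function.Surjective (chartRed φ h) :=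
  Ideal.quotientMap_surjective (MvPolynomial.map_surjective φ hφ)

end Reduction

/-! ### Divided powers of the invariant field -/

lemma chartO_smul_def (r : R) (f : W.ChartO) : r • f = algebraMap R W.ChartO r * f :=
  Algebra.smul_def r f

/-- The operator `(P² + a₁ P) / 2`. -/
def halfOp : Module.End R W.ChartO where
  toFun f := (W.jetO f).c₂
  map_add' f g := by simp
  map_smul' r f := by simp [chartO_smul_def, jetO_algebraMap]

/-- The operator `(P³ + 3 a₁ P² + 2 (a₁² + a₂) P) / 6`. -/
def sixthOp : Module.End R W.ChartO where
  toFun f := (W.jetO f).c₃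
  map_add' f g := by simp
  map_smul' r f := by simp [chartO_smul_def, jetO_algebraMap]

lemma halfOp_apply (f : W.ChartO) : W.halfOp f = (W.jetO f).c₂ := rfl

lemma sixthOp_apply (f : W.ChartO) : W.sixthOp f = (W.jetO f).c₃ := rfl

/-- Serves to compare operators of higher order: if two of them have the same defect from the
Leibniz rule, their difference is a derivation, and it suffices to compare them on `z` and `w`. -/
lemma eq_zero_of_leibniz {δ : Module.End R W.ChartO}
    (hmul : ∀ f g, δ (f * g) = f * δ g + g * δ f) (hz : δ W.zO = 0) (hw : δ W.wO = 0) : δ = 0 := by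
  have h1 : δ 1 = 0 := by simpa using hmul 1 1
  refine LinearMap.ext fun f => ?_
  obtain ⟨f, rfl⟩ := Ideal.Quotient.mk_surjective f
  change δ _ = 0
  induction f using MvPolynomial.induction_on with
  | C r =>
    change δ (algebraMap R W.ChartO r) = 0
    rw [Algebra.algebraMap_eq_smul_one, map_smul, h1, smul_zero]
  | add p q hp hq => rw [map_add, map_add, hp, hq, add_zero]
  | mul_X p i hp =>
    rw [map_mul, hmul, hp, mul_zero, add_zero]
    fin_cases i
    · exact (congrArg _ hz).trans (mul_zero _)
    · exact (congrArg _ hw).trans (mul_zero _)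

lemma invField_mk (f : MvPolynomial (Fin 2) R) :
    W.invField (Ideal.Quotient.mk _ f) = Ideal.Quotient.mk _ (W.planeField f) :=
  Derivation.liftOfSurjective_apply (Ideal.Quotient.mkₐ_surjective R _) W.planeField_mem f

end WeierstrassCurve

end

noncomputable section

namespace WeierstrassCurve

variable {R : Type u} [CommRing R] (W : WeierstrassCurve R)

lemma invField_zO : W.invField W.zO = (W.baseO.jetZ W.zO W.wO).c₁ := by
  have h : W.planeField zz = 1 - MvPolynomial.C W.a₁ * zz - 2 * MvPolynomial.C W.a₃ * ww
      - MvPolynomial.C W.a₂ * zz ^ 2 - 2 * MvPolynomial.C W.a₄ * zz * ww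
      - 3 * MvPolynomial.C W.a₆ * ww ^ 2 := by
    simp [planeField]
  rw [invField_mk, h]
  have e (r : R) : Ideal.Quotient.mk (Ideal.span {W.eqO}) (MvPolynomial.C r) =
    algebraMap R W.ChartO r := rfl
  simp only [map_sub, map_mul, map_pow, map_one, map_ofNat, e, jetZ, map_a₁, map_a₂, map_a₃,
    map_a₄, map_a₆]
  ring

lemma invField_wO : W.invField W.wO = (W.baseO.jetW W.zO W.wO).c₁ := by
  have h : W.planeField ww = MvPolynomial.C W.a₁ * ww + 3 * zz ^ 2
      + 2 * MvPolynomial.C W.a₂ * zz * ww + MvPolynomial.C W.a₄ * ww ^ 2 := by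
    simp [planeField]
  rw [invField_mk, h]
  have e (r : R) : Ideal.Quotient.mk (Ideal.span {W.eqO}) (MvPolynomial.C r) =
    algebraMap R W.ChartO r := rfl
  simp only [map_add, map_mul, map_pow, map_ofNat, e, jetW, map_a₁, map_a₂, map_a₃,
    map_a₄, map_a₆]
  ring

lemma invField_algebraMap_mul (r : R) (f : W.ChartO) :
    W.invField (algebraMap R _ r * f) = algebraMap R _ r * W.invField f := by
  rw [Derivation.leibniz, Derivation.map_algebraMap, smul_zero, add_zero, smul_eq_mul]

lemma jetO_c₁ (f : W.ChartO) : (W.jetO f).c₁ = W.invField f := by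
  let δ : Module.End R W.ChartO :=
    { toFun := fun f => (W.jetO f).c₁ - W.invField f
      map_add' := fun f g => by simp; ring
      map_smul' := fun r f => by
        simp [chartO_smul_def, jetO_algebraMap, mul_sub] }
  have hδ (f) : δ f = (W.jetO f).c₁ - W.invField f := rfl
  have : δ = 0 := W.eq_zero_of_leibniz
    (fun f g => by simp [hδ, jetO_c₀]; ring)
    (by rw [hδ, jetO_zO, invField_zO, sub_self]) (by rw [hδ, jetO_wO, invField_wO, sub_self])
  exact sub_eq_zero.1 (LinearMap.congr_fun this f)

lemma invField_two : W.invField 2 = 0 := Derivation.map_natCast W.invField 2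

lemma invField_three : W.invField 3 = 0 := Derivation.map_natCast W.invField 3

/-- Both sides have the Leibniz defect `2 P(f) P(g)`, so only the values at `z` and `w` matter.
There the identity is polynomial and does not use the curve equation. -/
lemma two_mul_halfOp (f : W.ChartO) :
    2 * W.halfOp f = W.invField (W.invField f) + algebraMap R _ W.a₁ * W.invField f := by
  let δ : Module.End R W.ChartO :=
    { toFun := fun f => 2 * W.halfOp f -
        (W.invField (W.invField f) + algebraMap R _ W.a₁ * W.invField f)
      map_add' := fun f g => by simp only [map_add]; ring
      map_smul' := fun r f => by
        simp only [chartO_smul_def, invField_algebraMap_mul, halfOp_apply, map_mul,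
          jetO_algebraMap, Jet.mul_c₂, Jet.const_c₀, Jet.const_c₁, Jet.const_c₂, RingHom.id_apply]
        ring }
  have hδ (f) : δ f = 2 * W.halfOp f -
    (W.invField (W.invField f) + algebraMap R _ W.a₁ * W.invField f) := rfl
  have : δ = 0 := by
    refine W.eq_zero_of_leibniz (fun f g => ?_) ?_ ?_
    · simp only [hδ, halfOp_apply, map_mul, Jet.mul_c₂, jetO_c₀, jetO_c₁, Derivation.leibniz,
        map_add, smul_eq_mul]
      ring
    · simp only [hδ, halfOp_apply, jetO_zO, invField_zO, jetZ, map_a₁, map_a₂, map_a₃, map_a₄,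
        map_a₆, map_add, map_sub, map_neg, Derivation.leibniz, Derivation.leibniz_pow,
        Derivation.map_algebraMap, invField_two, invField_three, Derivation.map_one_eq_zero, invField_wO, jetW,
        smul_eq_mul, nsmul_eq_mul]
      push_cast
      ring
    · simp only [hδ, halfOp_apply, jetO_wO, invField_wO, jetW, map_a₁, map_a₂, map_a₃, map_a₄,
        map_a₆, map_add, Derivation.leibniz, Derivation.leibniz_pow,
        Derivation.map_algebraMap, invField_two, invField_three, invField_zO, jetZ,
        smul_eq_mul, nsmul_eq_mul]
      push_cast
      ring
  exact sub_eq_zero.1 (LinearMap.congr_fun this f)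

lemma six_mul_sixthOp (f : W.ChartO) :
    6 * W.sixthOp f = W.invField (W.invField (W.invField f))
      + 3 * algebraMap R _ W.a₁ * W.invField (W.invField f)
      + 2 * algebraMap R _ (W.a₁ ^ 2 + W.a₂) * W.invField f := by
  let δ : Module.End R W.ChartO :=
    { toFun := fun f => 6 * W.sixthOp f - (W.invField (W.invField (W.invField f))
        + 3 * algebraMap R _ W.a₁ * W.invField (W.invField f)
        + 2 * algebraMap R _ (W.a₁ ^ 2 + W.a₂) * W.invField f)
      map_add' := fun f g => by simp only [map_add]; ring
      map_smul' := fun r f => by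
        simp only [chartO_smul_def, invField_algebraMap_mul, sixthOp_apply, map_mul,
          jetO_algebraMap, Jet.mul_c₃, Jet.const_c₀, Jet.const_c₁, Jet.const_c₂, Jet.const_c₃,
          RingHom.id_apply]
        ring }
  have hδ (f) : δ f = 6 * W.sixthOp f - (W.invField (W.invField (W.invField f))
        + 3 * algebraMap R _ W.a₁ * W.invField (W.invField f)
        + 2 * algebraMap R _ (W.a₁ ^ 2 + W.a₂) * W.invField f) := rfl
  have : δ = 0 := by
    refine W.eq_zero_of_leibniz (fun f g => ?_) ?_ ?_
    -- The defects are `6 (P(f) D₂(g) + D₂(f) P(g))` and `3 P(f) P²(g) + 3 P²(f) P(g) + 6 a₁ P(f)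
    -- P(g)`; they agree because `2 D₂ = P² + a₁ P`.
    · have hf := W.two_mul_halfOp f
      have hg := W.two_mul_halfOp g
      simp only [hδ, sixthOp_apply, map_mul, Jet.mul_c₃, jetO_c₀, jetO_c₁, Derivation.leibniz,
        map_add, smul_eq_mul, ← halfOp_apply]
      linear_combination 3 * W.invField f * hg + 3 * W.invField g * hf
    · simp only [hδ, sixthOp_apply, jetO_zO, invField_zO, jetZ, map_a₁, map_a₂, map_a₃, map_a₄,
        map_a₆, map_add, map_sub, map_neg, Derivation.leibniz, Derivation.leibniz_pow,
        Derivation.map_algebraMap, invField_two, invField_three, Derivation.map_one_eq_zero, invField_wO, jetW,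
        smul_eq_mul, nsmul_eq_mul, map_pow, map_zero, Nat.cast_ofNat]
      push_cast
      ring
    · simp only [hδ, sixthOp_apply, jetO_wO, invField_wO, jetW, map_a₁, map_a₂, map_a₃, map_a₄,
        map_a₆, map_add, map_sub, map_neg, Derivation.leibniz, Derivation.leibniz_pow,
        Derivation.map_algebraMap, invField_two, invField_three, Derivation.map_one_eq_zero, invField_zO, jetZ,
        smul_eq_mul, nsmul_eq_mul, map_pow, map_zero, Nat.cast_ofNat]
      push_cast
      ring
  exact sub_eq_zero.1 (LinearMap.congr_fun this f)

end WeierstrassCurve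

end

/-! ### Open immersions of affine schemes and global differential operators -/

noncomputable section

namespace AlgebraicGeometry.Scheme

variable {X : Scheme.{u}}

lemma le_preimage_opensRange {Y : Scheme.{u}} (ι : Y ⟶ X) [IsOpenImmersion ι] :
    ⊤ ≤ ι ⁻¹ᵁ ι.opensRange :=
  fun x _ => ⟨x, rfl⟩

instance {Y : Scheme.{u}} (ι : Y ⟶ X) [IsOpenImmersion ι] :
    IsIso (ι.appLE ι.opensRange ⊤ (le_preimage_opensRange _)) := by
  have h : (⊤ : Y.Opens) = ι ⁻¹ᵁ ι.opensRange := ι.preimage_opensRange.symm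
  have : IsIso (ι.app ι.opensRange) := ι.isIso_app _ le_rfl
  have e : ι.appLE ι.opensRange ⊤ (le_preimage_opensRange _) =
      ι.app ι.opensRange ≫ Y.presheaf.map (eqToHom h).op := rfl
  rw [e]
  infer_instance

/-- The sections over the image of an open immersion `Spec B ⟶ X`. -/
def chartEquiv {B : Type u} [CommRing B] (ι : Spec (CommRingCat.of B) ⟶ X) [IsOpenImmersion ι] :
    Γ(X, ι.opensRange) ≃+* B :=
  (asIso ((ι.appLE ι.opensRange ⊤ (le_preimage_opensRange _)) ≫
    (Scheme.ΓSpecIso (CommRingCat.of B)).hom)).commRingCatIsoToRingEquiv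

lemma chartEquiv_apply {B : Type u} [CommRing B] (ι : Spec (CommRingCat.of B) ⟶ X)
    [IsOpenImmersion ι] (f : Γ(X, ι.opensRange)) :
    chartEquiv ι f = ((ι.appLE ι.opensRange ⊤ (le_preimage_opensRange _)) ≫
      (Scheme.ΓSpecIso (CommRingCat.of B)).hom) f := rfl

lemma chartEquiv_res {B C : Type u} [CommRing B] [CommRing C]
    (ι : Spec (CommRingCat.of B) ⟶ X) [IsOpenImmersion ι]
    (j : Spec (CommRingCat.of C) ⟶ X) [IsOpenImmersion j] (φ : B →+* C)
    (hj : j = Spec.map (CommRingCat.ofHom φ) ≫ ι) (h : j.opensRange ≤ ι.opensRange)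
    (f : Γ(X, ι.opensRange)) : chartEquiv j (X.res h f) = φ (chartEquiv ι f) := by
  subst hj
  rw [chartEquiv_apply, chartEquiv_apply]
  have e : X.presheaf.map (homOfLE h).op ≫
      ((Spec.map (CommRingCat.ofHom φ) ≫ ι).appLE
        (Spec.map (CommRingCat.ofHom φ) ≫ ι).opensRange ⊤ (le_preimage_opensRange _)) ≫
        (Scheme.ΓSpecIso (CommRingCat.of C)).hom =
      ((ι.appLE ι.opensRange ⊤ (le_preimage_opensRange _)) ≫
        (Scheme.ΓSpecIso (CommRingCat.of B)).hom) ≫ CommRingCat.ofHom φ := by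
    rw [Category.assoc, ← Scheme.ΓSpecIso_naturality, ← Category.assoc, ← Category.assoc]
    congr 1
    refine (Scheme.Hom.map_appLE _ (le_preimage_opensRange _) (homOfLE h).op).trans
      (Eq.trans ?_ (congrArg _ (Scheme.Hom.app_eq_appLE _)).symm)
    exact (Scheme.Hom.appLE_comp_appLE (Spec.map (CommRingCat.ofHom φ)) ι ι.opensRange ⊤ ⊤
      (le_preimage_opensRange _) le_rfl).symm
  exact ConcreteCategory.congr_hom e f

lemma chartEquiv_appLE {k B : Type u} [CommRing k] [CommRing B] [Algebra k B]
    (s : X ⟶ Spec (CommRingCat.of k)) (ι : Spec (CommRingCat.of B) ⟶ X) [IsOpenImmersion ι]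
    (h : ι ≫ s = Spec.map (CommRingCat.ofHom (algebraMap k B)))
    (c : Γ(Spec (CommRingCat.of k), ⊤)) :
    chartEquiv ι (s.appLE ⊤ ι.opensRange le_top c) =
      algebraMap k B ((Scheme.ΓSpecIso (CommRingCat.of k)).hom c) := by
  rw [chartEquiv_apply]
  have hs : ι.opensRange ≤ s ⁻¹ᵁ ⊤ := le_top
  have e : s.appLE ⊤ ι.opensRange hs ≫ ι.appLE ι.opensRange ⊤ (le_preimage_opensRange _) ≫
      (Scheme.ΓSpecIso (CommRingCat.of B)).hom =
      (Scheme.ΓSpecIso (CommRingCat.of k)).hom ≫ CommRingCat.ofHom (algebraMap k B) := by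
    rw [← Scheme.ΓSpecIso_naturality, ← h, ← Category.assoc]
    congr 1
    exact (Scheme.Hom.appLE_comp_appLE ι s ⊤ ι.opensRange ⊤ hs (le_preimage_opensRange _)).trans
      (Scheme.Hom.app_eq_appLE _).symm
  exact ConcreteCategory.congr_hom e c

lemma res_appLE {Y : Scheme.{u}} (s : X ⟶ Y) {U V : X.Opens} (h : V ≤ U) (c : Γ(Y, ⊤)) :
    X.res h (s.appLE ⊤ U le_top c) = s.appLE ⊤ V le_top c :=
  ConcreteCategory.congr_hom (s.appLE_map (U := ⊤) le_top (homOfLE h).op) c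

/-- The global differential operator `r₁ D₁ + r₂ D₂ + r₃ D₃`, where `D₁, D₂, D₃` are the components
of a Hasse–Schmidt derivation which is linear over the base. -/
def HasseSchmidt.globalDiffOp {k : Type u} [CommRing k] {s : X ⟶ Spec (CommRingCat.of k)}
    (D : X.HasseSchmidt)
    (hD : ∀ U c, D.toHom U (s.appLE ⊤ U le_top c) = Jet.const (s.appLE ⊤ U le_top c))
    (r₁ r₂ r₃ : Γ(Spec (CommRingCat.of k), ⊤)) : GlobalDiffOp s where
  op U :=
    (AddMonoidHom.mulLeft (s.appLE ⊤ U le_top r₁)).comp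
      (Jet.coeff₁.comp (D.toHom U).toAddMonoidHom) +
    (AddMonoidHom.mulLeft (s.appLE ⊤ U le_top r₂)).comp
      (Jet.coeff₂.comp (D.toHom U).toAddMonoidHom) +
    (AddMonoidHom.mulLeft (s.appLE ⊤ U le_top r₃)).comp
      (Jet.coeff₃.comp (D.toHom U).toAddMonoidHom)
  op_base U c f := by
    simp [hD]
    ring
  op_res U V h f := by
    have e := D.toHom_res U V h f
    have h₁ := X.res_appLE s h r₁
    have h₂ := X.res_appLE s h r₂
    have h₃ := X.res_appLE s h r₃
    simp only [res] at e h₁ h₂ h₃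
    simp [e, ← h₁, ← h₂, ← h₃]
  -- The order is at most 3 everywhere, so the whole scheme serves as the neighbourhood.
  locally_finite_order x := ⟨⊤, trivial, 3, fun V _ =>
    ((((isDiffOpLE_coeff₁ (D.c₀_toHom V)).mono (by norm_num)).mulLeft_comp _).add
      (((isDiffOpLE_coeff₂ (D.c₀_toHom V)).mono (by norm_num)).mulLeft_comp _)).add
      ((isDiffOpLE_coeff₃ (D.c₀_toHom V)).mulLeft_comp _)⟩

end AlgebraicGeometry.Scheme

namespace WeierstrassCurve

variable {R : Type u} [CommRing R] (W : WeierstrassCurve R)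

/-! ### Compatibility on the overlap -/

section Overlap

variable {C : Type u} [CommRing C] (τ : W.Overlap →+* C) (Ψ : C →+* Jet C)

/-- The Weierstrass equation `W` over a ring lying over the overlap of the two charts. -/
abbrev baseOverlap : WeierstrassCurve C := W.map (τ.comp (algebraMap R W.Overlap))

lemma equation_overlap :
    τ (algebraMap _ _ W.yA) ^ 2
      + (W.baseOverlap τ).a₁ * τ (algebraMap _ _ W.xA) * τ (algebraMap _ _ W.yA)
      + (W.baseOverlap τ).a₃ * τ (algebraMap _ _ W.yA)
      - (τ (algebraMap _ _ W.xA) ^ 3 + (W.baseOverlap τ).a₂ * τ (algebraMap _ _ W.xA) ^ 2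
        + (W.baseOverlap τ).a₄ * τ (algebraMap _ _ W.xA) + (W.baseOverlap τ).a₆) = 0 := by
  have h := congrArg τ (congrArg (algebraMap _ W.Overlap) W.eqA)
  simp only [map_add, map_mul, map_pow, ← IsScalarTower.algebraMap_apply] at h
  simp only [map_a₁, map_a₂, map_a₃, map_a₄, map_a₆, RingHom.comp_apply]
  linear_combination h

lemma y_mul_w_overlap :
    τ (algebraMap _ _ W.yA) * τ (W.chartOToOverlap W.wO) + 1 = 0 := by
  rw [chartOToOverlap_wO, ← map_mul, mul_neg, y_mul_yInv, map_neg, map_one, neg_add_cancel]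

lemma z_overlap : τ (W.chartOToOverlap W.zO) =
    τ (algebraMap _ _ W.xA) * τ (W.chartOToOverlap W.wO) := by
  rw [chartOToOverlap_wO, chartOToOverlap_zO, ← map_mul, mul_neg]

lemma jetY_mul_jetW_overlap :
    (W.baseOverlap τ).jetY (τ (algebraMap _ _ W.xA)) (τ (algebraMap _ _ W.yA)) *
      (W.baseOverlap τ).jetW (τ (W.chartOToOverlap W.zO)) (τ (W.chartOToOverlap W.wO)) = -1 := by
  rw [z_overlap]
  exact jetY_mul_jetW (W.equation_overlap τ) (W.y_mul_w_overlap τ)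

lemma jetX_mul_jetW_overlap :
    (W.baseOverlap τ).jetX (τ (algebraMap _ _ W.xA)) (τ (algebraMap _ _ W.yA)) *
      (W.baseOverlap τ).jetW (τ (W.chartOToOverlap W.zO)) (τ (W.chartOToOverlap W.wO)) =
      (W.baseOverlap τ).jetZ (τ (W.chartOToOverlap W.zO)) (τ (W.chartOToOverlap W.wO)) := by
  rw [z_overlap]
  exact jetX_mul_jetW (W.equation_overlap τ) (W.y_mul_w_overlap τ)

/-- `Ψ` extends the expansion of functions on the chart `{Z ≠ 0}`. -/
def ExtendsJetA : Prop := ∀ f, Ψ (τ (algebraMap _ _ f)) =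
  Jet.map (τ.comp (algebraMap W.toAffine.CoordinateRing W.Overlap)) (W.jetA f)

/-- `Ψ` extends the expansion of functions on the chart `{Y ≠ 0}`. -/
def ExtendsJetO : Prop := ∀ f, Ψ (τ (W.chartOToOverlap f)) =
  Jet.map (τ.comp W.chartOToOverlap.toRingHom) (W.jetO f)

lemma baseA_map_overlap :
    W.baseA.map (τ.comp (algebraMap W.toAffine.CoordinateRing W.Overlap)) = W.baseOverlap τ := by
  rw [map_map, RingHom.comp_assoc, ← IsScalarTower.algebraMap_eq]

lemma baseO_map_overlap :
    W.baseO.map (τ.comp W.chartOToOverlap.toRingHom) = W.baseOverlap τ := by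
  rw [map_map, RingHom.comp_assoc]
  congr 2
  exact W.chartOToOverlap.comp_algebraMap

/-- A ring homomorphism on the coordinate ring is determined by constants, `x` and `y`. This reduces
the comparison of the charts to the explicit formulas. -/
lemma extendsJetA_iff : W.ExtendsJetA τ Ψ ↔
    (∀ r, Ψ (τ (algebraMap R _ r)) = Jet.const (τ (algebraMap R _ r))) ∧
    Ψ (τ (algebraMap _ _ W.xA)) =
      (W.baseOverlap τ).jetX (τ (algebraMap _ _ W.xA)) (τ (algebraMap _ _ W.yA)) ∧
    Ψ (τ (algebraMap _ _ W.yA)) =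
      (W.baseOverlap τ).jetY (τ (algebraMap _ _ W.xA)) (τ (algebraMap _ _ W.yA)) := by
  have hr (r : R) : Jet.map (τ.comp (algebraMap W.toAffine.CoordinateRing W.Overlap))
      (W.jetA (algebraMap R _ r)) = Jet.const (τ (algebraMap R _ r)) := by
    rw [jetA_algebraMap, Jet.map_const, RingHom.comp_apply, ← IsScalarTower.algebraMap_apply]
  have hx : Jet.map (τ.comp (algebraMap W.toAffine.CoordinateRing W.Overlap)) (W.jetA W.xA) =
      (W.baseOverlap τ).jetX (τ (algebraMap _ _ W.xA)) (τ (algebraMap _ _ W.yA)) := by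
    rw [jetA_xA, map_jetX, baseA_map_overlap]; rfl
  have hy : Jet.map (τ.comp (algebraMap W.toAffine.CoordinateRing W.Overlap)) (W.jetA W.yA) =
      (W.baseOverlap τ).jetY (τ (algebraMap _ _ W.xA)) (τ (algebraMap _ _ W.yA)) := by
    rw [jetA_yA, map_jetY, baseA_map_overlap]; rfl
  constructor
  · intro h
    refine ⟨fun r => ?_, (h _).trans hx, (h _).trans hy⟩
    rw [IsScalarTower.algebraMap_apply R W.toAffine.CoordinateRing, h, hr,
      ← IsScalarTower.algebraMap_apply]
  · rintro ⟨h₁, h₂, h₃⟩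
    refine RingHom.congr_fun (W.coordinateRing_hom_ext
      (f := Ψ.comp (τ.comp (algebraMap W.toAffine.CoordinateRing W.Overlap)))
      (g := (Jet.map (τ.comp (algebraMap _ W.Overlap))).comp W.jetA) (fun r => ?_)
      (h₂.trans hx.symm) (h₃.trans hy.symm))
    simp only [RingHom.comp_apply]
    rw [hr, ← h₁, ← IsScalarTower.algebraMap_apply]

lemma extendsJetO_iff : W.ExtendsJetO τ Ψ ↔
    (∀ r, Ψ (τ (algebraMap R _ r)) = Jet.const (τ (algebraMap R _ r))) ∧
    Ψ (τ (W.chartOToOverlap W.zO)) =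
      (W.baseOverlap τ).jetZ (τ (W.chartOToOverlap W.zO)) (τ (W.chartOToOverlap W.wO)) ∧
    Ψ (τ (W.chartOToOverlap W.wO)) =
      (W.baseOverlap τ).jetW (τ (W.chartOToOverlap W.zO)) (τ (W.chartOToOverlap W.wO)) := by
  have hr (r : R) : Jet.map (τ.comp W.chartOToOverlap.toRingHom)
      (W.jetO (algebraMap R _ r)) = Jet.const (τ (algebraMap R _ r)) := by
    rw [jetO_algebraMap, Jet.map_const]
    exact congrArg _ (congrArg τ (W.chartOToOverlap.commutes r))
  have hz : Jet.map (τ.comp W.chartOToOverlap.toRingHom) (W.jetO W.zO) =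
      (W.baseOverlap τ).jetZ (τ (W.chartOToOverlap W.zO)) (τ (W.chartOToOverlap W.wO)) := by
    rw [jetO_zO, map_jetZ, baseO_map_overlap]; rfl
  have hw : Jet.map (τ.comp W.chartOToOverlap.toRingHom) (W.jetO W.wO) =
      (W.baseOverlap τ).jetW (τ (W.chartOToOverlap W.zO)) (τ (W.chartOToOverlap W.wO)) := by
    rw [jetO_wO, map_jetW, baseO_map_overlap]; rfl
  constructor
  · intro h
    refine ⟨fun r => ?_, (h _).trans hz, (h _).trans hw⟩
    rw [← W.chartOToOverlap.commutes, h, hr, AlgHom.commutes]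
  · rintro ⟨h₁, h₂, h₃⟩
    refine RingHom.congr_fun (W.chartO_hom_ext
      (f := Ψ.comp (τ.comp W.chartOToOverlap.toRingHom))
      (g := (Jet.map (τ.comp W.chartOToOverlap.toRingHom)).comp W.jetO) (fun r => ?_)
      (h₂.trans hz.symm) (h₃.trans hw.symm))
    exact (congrArg _ (congrArg τ (W.chartOToOverlap.commutes r))).trans
      ((h₁ r).trans (hr r).symm)

/-- The expansions of functions on the two charts agree on the overlap. -/
lemma extendsJetA_iff_extendsJetO : W.ExtendsJetA τ Ψ ↔ W.ExtendsJetO τ Ψ := by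
  rw [extendsJetA_iff, extendsJetO_iff]
  refine and_congr_right fun _ => ?_
  have h₁ := W.jetY_mul_jetW_overlap τ
  have h₂ := W.jetX_mul_jetW_overlap τ
  -- The values of `Ψ` satisfy `y w = -1` and `z = x w` because `Ψ` is a ring homomorphism; the
  -- explicit jets satisfy the same relations by `h₁` and `h₂`. Each pair of coordinates thus
  -- determines the other.
  have h₃ := congrArg Ψ (W.y_mul_w_overlap τ)
  have h₄ := congrArg Ψ (W.z_overlap τ)
  rw [map_add, map_mul, map_one, map_zero] at h₃
  rw [map_mul] at h₄
  constructor
  · rintro ⟨hx, hy⟩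
    rw [hx] at h₄
    rw [hy] at h₃
    -- Both sides are the negative of the inverse of the same jet of `y`.
    have hw : Ψ (τ (W.chartOToOverlap W.wO)) = (W.baseOverlap τ).jetW
        (τ (W.chartOToOverlap W.zO)) (τ (W.chartOToOverlap W.wO)) := by
      linear_combination Ψ (τ (W.chartOToOverlap W.wO)) * h₁ - (W.baseOverlap τ).jetW
        (τ (W.chartOToOverlap W.zO)) (τ (W.chartOToOverlap W.wO)) * h₃
    exact ⟨by rw [h₄, hw, h₂], hw⟩
  · rintro ⟨hz, hw⟩
    rw [hw] at h₃
    rw [hw, hz] at h₄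
    constructor
    -- The jet of `w` is invertible with inverse `-jetY`, so it can be cancelled from `x w = z`.
    · linear_combination (W.baseOverlap τ).jetY (τ (algebraMap _ _ W.xA))
        (τ (algebraMap _ _ W.yA)) * (h₂ + h₄) - ((W.baseOverlap τ).jetX
        (τ (algebraMap _ _ W.xA)) (τ (algebraMap _ _ W.yA)) - Ψ (τ (algebraMap _ _ W.xA))) * h₁
    · linear_combination Ψ (τ (algebraMap _ _ W.yA)) * h₁ - (W.baseOverlap τ).jetY
        (τ (algebraMap _ _ W.xA)) (τ (algebraMap _ _ W.yA)) * h₃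

end Overlap

end WeierstrassCurve

end

noncomputable section

namespace WeierstrassCurve

variable {R : Type u} [CommRing R] (W : WeierstrassCurve R)

/-! ### The Hasse–Schmidt derivation of the projective curve -/

/-- The open immersion of the overlap in the curve. -/
def ιAO : Spec (CommRingCat.of W.Overlap) ⟶ W.curve := W.overlapToA ≫ W.ιA

instance : IsOpenImmersion W.ιAO := by
  unfold ιAO
  infer_instance

lemma ιAO_eq_overlapToA : W.ιAO = Spec.map (CommRingCat.ofHom (algebraMap _ _)) ≫ W.ιA := rfl

lemma ιAO_eq_overlapToO :
    W.ιAO = Spec.map (CommRingCat.ofHom W.chartOToOverlap.toRingHom) ≫ W.ιO :=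
  pushout.condition

lemma mem_opensRange_or (x : W.curve) : x ∈ W.ιA.opensRange ∨ x ∈ W.ιO.opensRange := by
  obtain ⟨i, y, rfl⟩ := Scheme.IsLocallyDirected.ι_jointly_surjective
    (span W.overlapToA W.overlapToO) x
  rcases i with _ | _ | _
  -- A point of the overlap is counted in the chart `{Z ≠ 0}`.
  · refine Or.inl ⟨W.overlapToA y, ?_⟩
    exact (Scheme.Hom.comp_apply W.overlapToA W.ιA y).symm.trans
      (congrArg (fun f : Spec (CommRingCat.of W.Overlap) ⟶ W.curve => f y)
        (colimit.w (span W.overlapToA W.overlapToO) WalkingSpan.Hom.fst))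
  · exact Or.inl ⟨y, rfl⟩
  · exact Or.inr ⟨y, rfl⟩

/-- In a gluing along open immersions, points of two charts are identified only if they come from a
point of one object of the diagram mapping to both. In a span that object is the apex, since there
is no arrow between the two feet. -/
lemma mem_opensRange_ιAO {x : W.curve} (hA : x ∈ W.ιA.opensRange) (hO : x ∈ W.ιO.opensRange) :
    x ∈ W.ιAO.opensRange := by
  obtain ⟨a, rfl⟩ := hA
  obtain ⟨b, hb⟩ := hO
  obtain ⟨i, f, g, y, hf, hg⟩ := (Scheme.IsLocallyDirected.ι_eq_ι_iff
    (span W.overlapToA W.overlapToO) (i := WalkingSpan.left) (j := WalkingSpan.right)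
    (xi := a) (xj := b)).1 hb.symm
  rcases i with _ | _ | _
  · refine ⟨y, ?_⟩
    obtain rfl : f = WalkingSpan.Hom.fst := Subsingleton.elim _ _
    exact (Scheme.Hom.comp_apply W.overlapToA W.ιA y).trans (congrArg W.ιA hf)
  · exact nomatch (show WidePushoutShape.Hom (some WalkingPair.left) (some WalkingPair.right) from g)
  · exact nomatch (show WidePushoutShape.Hom (some WalkingPair.right) (some WalkingPair.left) from f)

lemma opensRange_ιAO_le_ιA : W.ιAO.opensRange ≤ W.ιA.opensRange := by
  rintro _ ⟨y, rfl⟩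
  exact ⟨W.overlapToA y, (Scheme.Hom.comp_apply _ _ _).symm⟩

lemma opensRange_ιAO_le_ιO : W.ιAO.opensRange ≤ W.ιO.opensRange := by
  rintro _ ⟨y, rfl⟩
  rw [ιAO_eq_overlapToO]
  exact ⟨W.overlapToO y, (Scheme.Hom.comp_apply _ _ _).symm⟩

/-- Sections over an open subset of both charts form an algebra over the ring of the overlap. -/
lemma exists_overlap_hom (V : W.curve.Opens) (hA : V ≤ W.ιA.opensRange)
    (hO : V ≤ W.ιO.opensRange) : ∃ τ : W.Overlap →+* Γ(W.curve, V),
      (∀ f, τ (algebraMap _ _ f) = W.curve.res hA ((Scheme.chartEquiv W.ιA).symm f)) ∧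
      ∀ f, τ (W.chartOToOverlap f) = W.curve.res hO ((Scheme.chartEquiv W.ιO).symm f) := by
  have h : V ≤ W.ιAO.opensRange := fun x hx => W.mem_opensRange_ιAO (hA hx) (hO hx)
  refine ⟨(W.curve.res h).comp (Scheme.chartEquiv W.ιAO).symm.toRingHom, fun f => ?_, fun f => ?_⟩
  · have e := Scheme.chartEquiv_res W.ιA W.ιAO _ W.ιAO_eq_overlapToA W.opensRange_ιAO_le_ιA
      ((Scheme.chartEquiv W.ιA).symm f)
    rw [RingEquiv.apply_symm_apply] at e
    rw [← e, ← W.curve.res_res W.opensRange_ιAO_le_ιA h]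
    exact congrArg _ (RingEquiv.symm_apply_apply _ _)
  · have e := Scheme.chartEquiv_res W.ιO W.ιAO _ W.ιAO_eq_overlapToO W.opensRange_ιAO_le_ιO
      ((Scheme.chartEquiv W.ιO).symm f)
    rw [RingEquiv.apply_symm_apply] at e
    rw [← W.curve.res_res W.opensRange_ιAO_le_ιO h]
    exact (congrArg (fun g => W.curve.res h ((Scheme.chartEquiv W.ιAO).symm g)) e.symm).trans
      (congrArg _ (RingEquiv.symm_apply_apply _ _))

/-- The expansion of sections over the chart `{Z ≠ 0}`. -/
def sectionJetA : Γ(W.curve, W.ιA.opensRange) →+* Jet Γ(W.curve, W.ιA.opensRange) :=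
  (Jet.map (Scheme.chartEquiv W.ιA).symm.toRingHom).comp
    (W.jetA.comp (Scheme.chartEquiv W.ιA).toRingHom)

/-- The expansion of sections over the chart `{Y ≠ 0}`. -/
def sectionJetO : Γ(W.curve, W.ιO.opensRange) →+* Jet Γ(W.curve, W.ιO.opensRange) :=
  (Jet.map (Scheme.chartEquiv W.ιO).symm.toRingHom).comp
    (W.jetO.comp (Scheme.chartEquiv W.ιO).toRingHom)

section

variable {V : W.curve.Opens} (Ψ : Γ(W.curve, V) →+* Jet Γ(W.curve, V))
  {τ : W.Overlap →+* Γ(W.curve, V)}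

lemma extends_sectionJetA_iff (hA : V ≤ W.ιA.opensRange)
    (hτ : ∀ f, τ (algebraMap _ _ f) = W.curve.res hA ((Scheme.chartEquiv W.ιA).symm f)) :
    (∀ f, Ψ (W.curve.res hA f) = Jet.map (W.curve.res hA) (W.sectionJetA f)) ↔
      W.ExtendsJetA τ Ψ := by
  have e : τ.comp (algebraMap W.toAffine.CoordinateRing W.Overlap) =
    (W.curve.res hA).comp (Scheme.chartEquiv W.ιA).symm.toRingHom := RingHom.ext hτ
  rw [ExtendsJetA, (Scheme.chartEquiv W.ιA).symm.surjective.forall]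
  refine forall_congr' fun f => ?_
  rw [hτ, e, ← Jet.map_map]
  simp [sectionJetA]

lemma extends_sectionJetO_iff (hO : V ≤ W.ιO.opensRange)
    (hτ : ∀ f, τ (W.chartOToOverlap f) = W.curve.res hO ((Scheme.chartEquiv W.ιO).symm f)) :
    (∀ f, Ψ (W.curve.res hO f) = Jet.map (W.curve.res hO) (W.sectionJetO f)) ↔
      W.ExtendsJetO τ Ψ := by
  have e : τ.comp W.chartOToOverlap.toRingHom =
    (W.curve.res hO).comp (Scheme.chartEquiv W.ιO).symm.toRingHom := RingHom.ext hτ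
  rw [ExtendsJetO, (Scheme.chartEquiv W.ιO).symm.surjective.forall]
  refine forall_congr' fun f => ?_
  rw [hτ, e, ← Jet.map_map]
  simp [sectionJetO]

end

/-- The two affine charts cover the curve. On an open subset of both, extending either expansion is
a condition on the coordinates of the overlap, and `extendsJetA_iff_extendsJetO` says that the two
conditions coincide. -/
lemma exists_hasseSchmidt : ∃ D : W.curve.HasseSchmidt,
    D.toHom W.ιA.opensRange = W.sectionJetA ∧ D.toHom W.ιO.opensRange = W.sectionJetO := by
  let U : Bool → W.curve.Opens := fun s => if s then W.ιA.opensRange else W.ιO.opensRange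
  let Φ : ∀ s, Γ(W.curve, U s) →+* Jet Γ(W.curve, U s)
    | true => W.sectionJetA
    | false => W.sectionJetO
  obtain ⟨D, hD⟩ := Scheme.HasseSchmidt.exists_of_affineCover W.curve U
    (by
      rintro (_ | _)
      exacts [isAffineOpen_opensRange W.ιO, isAffineOpen_opensRange W.ιA])
    (fun x => (W.mem_opensRange_or x).elim (fun h => ⟨true, h⟩) fun h => ⟨false, h⟩)
    Φ
    (by
      rintro (_ | _) f
      · change (W.sectionJetO f).c₀ = f
        simp [sectionJetO, jetO_c₀]
      · change (W.sectionJetA f).c₀ = f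
        simp [sectionJetA, jetA_c₀])
    (by
      rintro (_ | _) (_ | _) V hs ht Ψ h
      · exact h
      · obtain ⟨τ, h₁, h₂⟩ := W.exists_overlap_hom V ht hs
        exact (W.extends_sectionJetA_iff Ψ ht h₁).2 ((W.extendsJetA_iff_extendsJetO τ Ψ).2
          ((W.extends_sectionJetO_iff Ψ hs h₂).1 h))
      · obtain ⟨τ, h₁, h₂⟩ := W.exists_overlap_hom V hs ht
        exact (W.extends_sectionJetO_iff Ψ ht h₂).2 ((W.extendsJetA_iff_extendsJetO τ Ψ).1
          ((W.extends_sectionJetA_iff Ψ hs h₁).1 h))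
      · exact h)
  exact ⟨D, hD true, hD false⟩

lemma ιA_toBase :
    W.ιA ≫ W.toBase = Spec.map (CommRingCat.ofHom (algebraMap R W.toAffine.CoordinateRing)) :=
  pushout.inl_desc _ _ _

lemma ιO_toBase : W.ιO ≫ W.toBase = Spec.map (CommRingCat.ofHom (algebraMap R W.ChartO)) :=
  pushout.inr_desc _ _ _

lemma sectionJetA_base (c : Γ(Spec (CommRingCat.of R), ⊤)) :
    W.sectionJetA (W.toBase.appLE ⊤ W.ιA.opensRange le_top c) =
      Jet.const (W.toBase.appLE ⊤ W.ιA.opensRange le_top c) := by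
  have h := Scheme.chartEquiv_appLE W.toBase W.ιA W.ιA_toBase c
  have h' := (RingEquiv.symm_apply_eq _).2 h.symm
  refine (congrArg (Jet.map (Scheme.chartEquiv W.ιA).symm.toRingHom)
    ((congrArg W.jetA h).trans (W.jetA_algebraMap _))).trans ?_
  rw [Jet.map_const]
  exact congrArg _ h'

lemma sectionJetO_base (c : Γ(Spec (CommRingCat.of R), ⊤)) :
    W.sectionJetO (W.toBase.appLE ⊤ W.ιO.opensRange le_top c) =
      Jet.const (W.toBase.appLE ⊤ W.ιO.opensRange le_top c) := by
  have h := Scheme.chartEquiv_appLE W.toBase W.ιO W.ιO_toBase c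
  have h' := (RingEquiv.symm_apply_eq _).2 h.symm
  refine (congrArg (Jet.map (Scheme.chartEquiv W.ιO).symm.toRingHom)
    ((congrArg W.jetO h).trans (W.jetO_algebraMap _))).trans ?_
  rw [Jet.map_const]
  exact congrArg _ h'

/-- The combinations of `P`, `(P² + a₁ P) / 2` and `(P³ + 3 a₁ P² + 2 (a₁² + a₂) P) / 6` extend to
the projective curve. -/
theorem isGlobal_linearCombination (r₁ r₂ r₃ : R) :
    W.IsGlobal (r₁ • W.invOp + r₂ • W.halfOp + r₃ • W.sixthOp) := by
  obtain ⟨D, hA, hO⟩ := W.exists_hasseSchmidt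
  have hD (U : W.curve.Opens) (c) : D.toHom U (W.toBase.appLE ⊤ U le_top c) =
      Jet.const (W.toBase.appLE ⊤ U le_top c) := by
    -- Linearity over the base is checked for global sections, on each chart, and then restricted to
    -- `U`.
    have h : D.toHom ⊤ (W.toBase.appLE ⊤ ⊤ le_top c) =
        Jet.const (W.toBase.appLE ⊤ ⊤ le_top c) := by
      refine W.curve.jet_ext fun x _ => ?_
      obtain hx | hx := W.mem_opensRange_or x
      · refine ⟨W.ιA.opensRange, le_top, hx, ?_⟩
        rw [← D.toHom_res, Scheme.res_appLE, hA, sectionJetA_base, Jet.map_const,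
          Scheme.res_appLE]
      · refine ⟨W.ιO.opensRange, le_top, hx, ?_⟩
        rw [← D.toHom_res, Scheme.res_appLE, hO, sectionJetO_base, Jet.map_const,
          Scheme.res_appLE]
    have e := D.toHom_res ⊤ U le_top (W.toBase.appLE ⊤ ⊤ le_top c)
    rwa [h, Jet.map_const, Scheme.res_appLE] at e
  let i := (Scheme.ΓSpecIso (CommRingCat.of R)).inv
  refine ⟨D.globalDiffOp hD (i r₁) (i r₂) (i r₃), fun f => ?_⟩
  have hi (r : R) : Scheme.chartEquiv W.ιO (W.toBase.appLE ⊤ W.ιO.opensRange le_top (i r)) =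
      algebraMap R W.ChartO r := by
    rw [Scheme.chartEquiv_appLE W.toBase W.ιO W.ιO_toBase]
    exact congrArg _ (ConcreteCategory.congr_hom (Scheme.ΓSpecIso (CommRingCat.of R)).inv_hom_id r)
  have e : D.toHom W.ιO.opensRange f = Jet.map (Scheme.chartEquiv W.ιO).symm.toRingHom
      (W.jetO (Scheme.chartEquiv W.ιO f)) := by rw [hO]; rfl
  change Scheme.chartEquiv W.ιO
    (W.toBase.appLE ⊤ W.ιO.opensRange le_top (i r₁) * (D.toHom W.ιO.opensRange f).c₁ +
    W.toBase.appLE ⊤ W.ιO.opensRange le_top (i r₂) * (D.toHom W.ιO.opensRange f).c₂ +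
    W.toBase.appLE ⊤ W.ιO.opensRange le_top (i r₃) * (D.toHom W.ιO.opensRange f).c₃) =
    r₁ • W.invField (Scheme.chartEquiv W.ιO f) + r₂ • W.halfOp (Scheme.chartEquiv W.ιO f) +
    r₃ • W.sixthOp (Scheme.chartEquiv W.ιO f)
  simp only [map_add, map_mul, hi, chartO_smul_def, e, Jet.map_c₁, Jet.map_c₂, Jet.map_c₃,
    halfOp_apply, sixthOp_apply, ← jetO_c₁]
  simp

end WeierstrassCurve

end

noncomputable section

namespace WeierstrassCurve

/-! ### The expansion of the invariant differential -/

section Expansion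

variable {R : Type u} [CommRing R] (W : WeierstrassCurve R)

open PowerSeries in
-- On multiples of `X ^ 3` every term of `wStep` other than `X ^ 3` is divisible by `X ^ 4`.
lemma exists_wStep_eq (g : PowerSeries R) :
    ∃ h, W.wStep (X ^ 3 * g) = X ^ 3 * (1 + X * h) :=
  ⟨C W.a₁ * g + C W.a₂ * X * g + C W.a₃ * X ^ 2 * g ^ 2 + C W.a₄ * X ^ 3 * g ^ 2
    + C W.a₆ * X ^ 5 * g ^ 3, by rw [wStep]; ring⟩

open PowerSeries in
lemma exists_wStep_iterate_eq (n : ℕ) :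
    ∃ h, W.wStep^[n + 1] 0 = X ^ 3 * (1 + X * h) := by
  induction n with
  | zero => exact ⟨0, by simp [wStep]⟩
  | succ n ih =>
    obtain ⟨h, hh⟩ := ih
    rw [Function.iterate_succ_apply', hh]
    exact W.exists_wStep_eq _

open PowerSeries in
-- The leading term `w = z³ + ⋯` is all that the coefficients of `ω` up to `z³` require, so the
-- functional equation of the limit series is not needed.
lemma exists_wSeries_eq : ∃ g, W.wSeries = X ^ 3 * g ∧ constantCoeff g = 1 := by
  have h0 (n : ℕ) (hn : n < 3) : coeff n W.wSeries = 0 := by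
    rw [wSeries, coeff_mk]
    cases n with
    | zero => simp
    | succ n =>
      obtain ⟨h, hh⟩ := W.exists_wStep_iterate_eq n
      rw [hh, coeff_X_pow_mul', if_neg (by lia)]
  obtain ⟨g, hg⟩ := X_pow_dvd_iff.2 h0
  refine ⟨g, hg, ?_⟩
  have h3 : coeff 3 W.wSeries = 1 := by
    rw [wSeries, coeff_mk]
    -- The coefficient of `z³` is read off the third iterate, which has index `2 + 1` here.
    obtain ⟨h, hh⟩ := W.exists_wStep_iterate_eq 2
    rw [hh, coeff_X_pow_mul']
    simp
  rw [hg, coeff_X_pow_mul'] at h3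
  simpa using h3

open PowerSeries in
lemma exists_omegaSeries_eq : ∃ g, constantCoeff g = 2 * W.a₃ ∧
    W.omegaSeries = 1 + C W.a₁ * (X * W.omegaSeries) + C W.a₂ * (X ^ 2 * W.omegaSeries)
      + X ^ 3 * (g * W.omegaSeries) := by
  obtain ⟨g, hg, hg1⟩ := W.exists_wSeries_eq
  -- The witness is `(2a₃w + 2a₄zw + 3a₆w²) / z³`; the equation is then `denominator * ω = 1`,
  -- solved for `ω`.
  refine ⟨2 * C W.a₃ * g + 2 * C W.a₄ * X * g + 3 * C W.a₆ * X ^ 3 * g ^ 2, ?_, ?_⟩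
  · simp [hg1, map_ofNat (constantCoeff (R := R))]
  · have h := mul_invOfUnit (1 - C W.a₁ * X - 2 * C W.a₃ * W.wSeries - C W.a₂ * X ^ 2
      - 2 * C W.a₄ * X * W.wSeries - 3 * C W.a₆ * W.wSeries ^ 2) 1 (by simp [hg])
    rw [← omegaSeries, hg] at h
    linear_combination h

open PowerSeries in
-- The previous equation is a recursion: `α₁ = 1`, `α₂ = a₁`, `α₃ = a₁α₂ + a₂α₁` and `α₄ = a₁α₃ +
-- a₂α₂ + 2a₃α₁`.
lemma coeff_omegaSeries : coeff 0 W.omegaSeries = 1 ∧ coeff 1 W.omegaSeries = W.a₁ ∧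
    coeff 3 W.omegaSeries = W.a₁ ^ 3 + 2 * W.a₁ * W.a₂ + 2 * W.a₃ := by
  obtain ⟨g, hg, h⟩ := W.exists_omegaSeries_eq
  have h0 := congrArg (coeff 0) h
  have h1 := congrArg (coeff 1) h
  have h2 := congrArg (coeff 2) h
  have h3 := congrArg (coeff 3) h
  simp only [map_add, coeff_C_mul, coeff_X_pow_mul', coeff_one, coeff_zero_X_mul] at h0
  simp only [map_add, coeff_C_mul, coeff_X_pow_mul', coeff_one,
    coeff_succ_X_mul 0] at h1
  simp only [map_add, coeff_C_mul, coeff_X_pow_mul', coeff_one,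
    coeff_succ_X_mul 1] at h2
  simp only [map_add, coeff_C_mul, coeff_X_pow_mul', coeff_one,
    coeff_succ_X_mul 2] at h3
  norm_num [hg] at h0 h1 h2 h3
  rw [← coeff_zero_eq_constantCoeff_apply] at h0 h1 h2 h3
  rw [h0] at h1 h2 h3
  refine ⟨h0, by simpa using h1, ?_⟩
  rw [h3, h2, h1]
  ring

lemma heisImage_one : W.heisImage (MvPolynomial.X 1 ^ 2 + MvPolynomial.X 2) =
    Polynomial.X ^ 2 + Polynomial.C W.a₁ * Polynomial.X := by
  obtain ⟨h0, h1, -⟩ := W.coeff_omegaSeries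
  have e1 : W.alpha 1 = 1 := h0
  have e2 : W.alpha 2 = W.a₁ := h1
  simp [heisImage, e1, e2]

lemma heisImage_two : W.heisImage (MvPolynomial.X 2 ^ 2 + MvPolynomial.X 4) =
    Polynomial.C (W.a₁ ^ 2) * Polynomial.X ^ 2 +
      Polynomial.C (W.a₁ ^ 3 + 2 * W.a₁ * W.a₂ + 2 * W.a₃) * Polynomial.X := by
  obtain ⟨-, h1, h3⟩ := W.coeff_omegaSeries
  have e2 : W.alpha 2 = W.a₁ := h1
  have e4 : W.alpha 4 = W.a₁ ^ 3 + 2 * W.a₁ * W.a₂ + 2 * W.a₃ := h3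
  simp only [heisImage, map_add, map_pow, MvPolynomial.eval₂Hom_X', e2, e4, mul_pow]

end Expansion

/-! ### Torsion in the ring of functions -/

section Torsion

variable {R : Type u} [CommRing R] (W : WeierstrassCurve R)

/-- After setting `z = 0`, the coefficient of `w` in the equation is `1`. -/
lemma not_C_dvd_eqO {q : R} (hq : ¬ IsUnit q) : ¬ MvPolynomial.C q ∣ W.eqO := by
  intro h
  have h' := map_dvd (MvPolynomial.aeval (R := R) ![0, (Polynomial.X : Polynomial R)]) h
  rw [MvPolynomial.algHom_C, Polynomial.algebraMap_eq, Polynomial.C_dvd_iff_dvd_coeff] at h'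
  have h1 := h' 1
  refine hq (isUnit_of_dvd_one ?_)
  simpa [eqO, Polynomial.coeff_X_pow] using h1

/-- If `q f` is a multiple `eqO * g` in the polynomial ring, the prime `q` does not divide `eqO`, so
it divides `g` and can be cancelled. -/
lemma chartO_eq_zero_of_prime [IsDomain R] {q : R} (hq : Prime q) {f : W.ChartO}
    (h : algebraMap R W.ChartO q * f = 0) : f = 0 := by
  obtain ⟨f, rfl⟩ := Ideal.Quotient.mk_surjective f
  have h' : Ideal.Quotient.mk (Ideal.span {W.eqO}) (MvPolynomial.C q * f) = 0 := by
    rw [map_mul]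
    exact h
  rw [Ideal.Quotient.eq_zero_iff_mem, Ideal.mem_span_singleton] at h' ⊢
  obtain ⟨g, hg⟩ := h'
  have hC : Prime (MvPolynomial.C q : MvPolynomial (Fin 2) R) :=
    (MvPolynomial.prime_C_iff _).2 hq
  obtain ⟨g, rfl⟩ := (hC.dvd_or_dvd ⟨f, hg.symm⟩).resolve_left (W.not_C_dvd_eqO hq.not_isUnit)
  exact ⟨g, mul_left_cancel₀ hC.ne_zero (by linear_combination hg)⟩

/-- Prime numbers remain prime in a polynomial ring over `ℤ`, so the prime factors of `n` are
cancelled one at a time. -/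
lemma chartO_eq_zero_of_natCast_mul {σ : Type u} (V : WeierstrassCurve (MvPolynomial σ ℤ)) {n : ℕ}
    (hn : n ≠ 0) {f : V.ChartO} (h : n • f = 0) : f = 0 := by
  induction n using Nat.recOnMul generalizing f with
  | zero => exact absurd rfl hn
  | one => simpa using h
  | prime p hp =>
    refine V.chartO_eq_zero_of_prime (q := MvPolynomial.C (p : ℤ))
      ((MvPolynomial.prime_C_iff _).2 (Nat.prime_iff_prime_int.1 hp)) ?_
    rw [nsmul_eq_mul] at h
    simpa using h
  | mul a b ha hb =>
    rw [mul_smul] at h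
    exact hb (right_ne_zero_of_mul hn) (ha (left_ne_zero_of_mul hn) h)

end Torsion

/-! ### The divided operators -/

section Divided

/-- The reduction `ℤ[X_c : c ∈ k] → k`, `X_c ↦ c`. -/
def universalRed (k : Type u) [CommRing k] : MvPolynomial k ℤ →+* k :=
  MvPolynomial.eval₂Hom (Int.castRingHom k) id

lemma universalRed_X {k : Type u} [CommRing k] (c : k) :
    universalRed k (MvPolynomial.X c) = c := by
  simp [universalRed]

/-- A combination of `P`, `(P² + a₁ P) / 2` and `(P³ + 3 a₁ P² + 2 (a₁² + a₂) P) / 6` whose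
coefficients depend naturally on the equation is the divided operator `q(P) / n`, if this holds
for all equations in the given family, and it extends to the projective curve. -/
theorem dividedOpIsGlobal_of_eq {k : Type u} [CommRing k] (W : WeierstrassCurve k)
    (𝓕 : ∀ (R : Type u) [CommRing R], Set (WeierstrassCurve R))
    (q : ∀ (R : Type u) [CommRing R], WeierstrassCurve R → Polynomial R) {n : ℕ} (hn : n ≠ 0)
    (c₁ c₂ c₃ : ∀ (R : Type u) [CommRing R], WeierstrassCurve R → R)
    (h₁ : ∀ (R : Type u) [CommRing R] (φ : R →+* k) (V : WeierstrassCurve R),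
      c₁ k (V.map φ) = φ (c₁ R V))
    (h₂ : ∀ (R : Type u) [CommRing R] (φ : R →+* k) (V : WeierstrassCurve R),
      c₂ k (V.map φ) = φ (c₂ R V))
    (h₃ : ∀ (R : Type u) [CommRing R] (φ : R →+* k) (V : WeierstrassCurve R),
      c₃ k (V.map φ) = φ (c₃ R V))
    (hq : ∀ (R : Type u) [CommRing R], ∀ V ∈ 𝓕 R,
      n • (c₁ R V • V.invOp + c₂ R V • V.halfOp + c₃ R V • V.sixthOp) =
        Polynomial.aeval V.invOp (q R V))
    (hlift : ∃ V ∈ 𝓕 (MvPolynomial k ℤ), V.map (universalRed k) = W) :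
    W.DividedOpIsGlobal 𝓕 q n := by
  have key : W.IsDividedOp 𝓕 q n
      (c₁ k W • W.invOp + c₂ k W • W.halfOp + c₃ k W • W.sixthOp) := by
    intro R _ _ φ V h hV
    refine ⟨_, hq R V hV, fun f => ?_⟩
    have e := jetO_chartRed φ h f
    have e₁ := congrArg Jet.c₁ e
    have e₂ := congrArg Jet.c₂ e
    have e₃ := congrArg Jet.c₃ e
    rw [Jet.map_c₁, jetO_c₁, jetO_c₁] at e₁
    subst h
    change c₁ k _ • invField _ (chartRed φ rfl f) + c₂ k _ • (jetO _ (chartRed φ rfl f)).c₂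
        + c₃ k _ • (jetO _ (chartRed φ rfl f)).c₃ =
      chartRed φ rfl (c₁ R V • V.invField f + c₂ R V • (V.jetO f).c₂ + c₃ R V • (V.jetO f).c₃)
    simp only [chartO_smul_def, map_add, map_mul, chartRed_algebraMap, h₁, h₂, h₃, e₁, e₂, e₃,
      Jet.map_c₂, Jet.map_c₃]
  refine ⟨_, key, fun E hE => ?_, W.isGlobal_linearCombination _ _ _⟩
  -- For uniqueness a single lift suffices: the quotients of `q(P)` by `n` agree there since its
  -- chart has no torsion, and every function over `k` is a reduction.
  obtain ⟨V, hV, h⟩ := hlift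
  obtain ⟨Q, hQ, hE⟩ := hE _ (universalRed k) V h hV
  obtain ⟨Q', hQ', hE'⟩ := key _ (universalRed k) V h hV
  have e : Q = Q' := by
    refine LinearMap.ext fun f => sub_eq_zero.1 (V.chartO_eq_zero_of_natCast_mul hn ?_)
    rw [smul_sub, sub_eq_zero]
    exact LinearMap.congr_fun (hQ.trans hQ'.symm) f
  refine LinearMap.ext fun f => ?_
  obtain ⟨f, rfl⟩ := chartRed_surjective (universalRed k) h
    (fun c => ⟨_, universalRed_X c⟩) f
  rw [hE, hE', e]

variable {R : Type u} [CommRing R] (V : WeierstrassCurve R)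

lemma two_nsmul_halfOp : 2 • V.halfOp = V.invOp ^ 2 + V.a₁ • V.invOp := by
  refine LinearMap.ext fun f => ?_
  have h := V.two_mul_halfOp f
  rw [← chartO_smul_def] at h
  rw [LinearMap.smul_apply, nsmul_eq_mul, Nat.cast_ofNat, h, pow_two]
  rfl

lemma six_nsmul_sixthOp : 6 • V.sixthOp = V.invOp ^ 3 + (3 * V.a₁) • V.invOp ^ 2
    + (2 * (V.a₁ ^ 2 + V.a₂)) • V.invOp := by
  refine LinearMap.ext fun f => ?_
  have h := V.six_mul_sixthOp f
  rw [LinearMap.smul_apply, nsmul_eq_mul, Nat.cast_ofNat, h, pow_succ V.invOp 2, pow_two V.invOp]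
  change _ = V.invField (V.invField (V.invField f)) + (3 * V.a₁) • V.invField (V.invField f)
    + (2 * (V.a₁ ^ 2 + V.a₂)) • V.invField f
  simp only [chartO_smul_def, map_mul, map_ofNat (algebraMap R V.ChartO)]

end Divided

end WeierstrassCurve

end

/-! ### The divided operators of the theorem as combinations of the components -/

theorem mainTheorem1 (p : ℕ) [Fact p.Prime] (k : Type u) [Field k] [CharP k p]
    [PerfectField k] :
    (∀ (W : WeierstrassCurve k) [W.IsElliptic],
      W.IsGlobal W.invOp ∧
      W.DividedOpIsGlobal (fun _ _ => Set.univ)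
        (fun _ _ V => V.heisImage (MvPolynomial.X 1 ^ 2 + MvPolynomial.X 2))
        (Nat.factorial 2) ∧
      W.DividedOpIsGlobal (fun _ _ => Set.univ)
        (fun _ _ V => V.heisImage (MvPolynomial.X 2 ^ 2 + MvPolynomial.X 4))
        (Nat.factorial 2)) ∧
    (∀ (R : Type u) [CommRing R] (V : WeierstrassCurve R),
      V.heisImage (MvPolynomial.X 1 ^ 2 + MvPolynomial.X 2) =
        Polynomial.X ^ 2 + Polynomial.C V.a₁ * Polynomial.X ∧
      V.heisImage (MvPolynomial.X 2 ^ 2 + MvPolynomial.X 4) =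
        Polynomial.C (V.a₁ ^ 2) * Polynomial.X ^ 2 +
          Polynomial.C (V.a₁ ^ 3 + 2 * V.a₁ * V.a₂ + 2 * V.a₃) * Polynomial.X) ∧
    (∀ (l : k) [(WeierstrassCurve.legendre l).IsElliptic],
      (WeierstrassCurve.legendre l).DividedOpIsGlobal
        (fun _ _ => Set.range WeierstrassCurve.legendre)
        (fun _ _ _ => Polynomial.X ^ 2)
        (Nat.factorial 2) ∧
      (WeierstrassCurve.legendre l).DividedOpIsGlobal
        (fun _ _ => Set.range WeierstrassCurve.legendre)
        (fun _ _ V => Polynomial.X ^ 3 - Polynomial.C (2 * (1 + V.a₄)) * Polynomial.X)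
        (Nat.factorial 3)) := by
  have lift (W : WeierstrassCurve k) :
      ∃ V ∈ (Set.univ : Set (WeierstrassCurve (MvPolynomial k ℤ))),
        V.map (WeierstrassCurve.universalRed k) = W :=
    -- The variables are indexed by the elements of `k`, so each coefficient lifts to the variable
    -- it names.
    ⟨⟨.X W.a₁, .X W.a₂, .X W.a₃, .X W.a₄, .X W.a₆⟩, trivial, by
      ext <;> simp [WeierstrassCurve.universalRed_X]⟩
  have lift_legendre (l : k) : ∃ V ∈ Set.range (WeierstrassCurve.legendre (R := MvPolynomial k ℤ)),
      V.map (WeierstrassCurve.universalRed k) = WeierstrassCurve.legendre l :=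
    ⟨_, ⟨.X l, rfl⟩, by ext <;> simp [WeierstrassCurve.legendre, WeierstrassCurve.universalRed_X]⟩
  refine ⟨fun W _ => ⟨?_, ?_, ?_⟩, fun R _ V => ⟨V.heisImage_one, V.heisImage_two⟩,
    fun l _ => ⟨?_, ?_⟩⟩
  · simpa using W.isGlobal_linearCombination 1 0 0
  · refine W.dividedOpIsGlobal_of_eq _ _ (Nat.factorial_ne_zero 2) (fun _ _ _ => 0)
      (fun _ _ _ => 1) (fun _ _ _ => 0) (by simp) (by simp) (by simp) (fun R _ V _ => ?_) (lift W)
    rw [V.heisImage_one, Nat.factorial_two, zero_smul, zero_smul, zero_add, add_zero, one_smul,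
      V.two_nsmul_halfOp, map_add, map_pow, ← Polynomial.smul_eq_C_mul, map_smul,
      Polynomial.aeval_X]
  · refine W.dividedOpIsGlobal_of_eq _ _ (Nat.factorial_ne_zero 2)
      -- Since `2 a₁² D₂ = a₁² P² + a₁³ P`, what remains of the operator is `(2a₁a₂ + 2a₃) P`, whose
      -- half is the coefficient of `P`.
      (fun _ _ V => V.a₁ * V.a₂ + V.a₃) (fun _ _ V => V.a₁ ^ 2) (fun _ _ _ => 0)
      (by simp) (by simp) (by simp) (fun R _ V _ => ?_) (lift W)
    rw [V.heisImage_two, Nat.factorial_two, zero_smul, add_zero, smul_add, smul_comm 2 (V.a₁ ^ 2),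
      V.two_nsmul_halfOp, map_add, ← Polynomial.smul_eq_C_mul, ← Polynomial.smul_eq_C_mul,
      map_smul, map_smul, map_pow, Polynomial.aeval_X]
    module
  · refine WeierstrassCurve.dividedOpIsGlobal_of_eq _ _ _ (Nat.factorial_ne_zero 2)
      (fun _ _ _ => 0) (fun _ _ _ => 1) (fun _ _ _ => 0) (by simp) (by simp) (by simp) ?_
      (lift_legendre l)
    rintro R _ V ⟨m, hm⟩
    have h₁ : V.a₁ = 0 := by rw [← hm]; rfl
    rw [Nat.factorial_two, zero_smul, zero_smul, zero_add, add_zero, one_smul,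
      V.two_nsmul_halfOp, h₁, zero_smul, add_zero, map_pow, Polynomial.aeval_X]
  · refine WeierstrassCurve.dividedOpIsGlobal_of_eq _ _ _ (Nat.factorial_ne_zero 3)
      (fun _ _ _ => 0) (fun _ _ _ => 0) (fun _ _ _ => 1) (by simp) (by simp) (by simp) ?_
      (lift_legendre l)
    rintro R _ V ⟨m, hm⟩
    have h₁ : V.a₁ = 0 := by rw [← hm]; rfl
    -- With `a₁ = 0` this turns `6 D₃` into `P³ - 2 (1 + a₄) P`, where `a₄` is the Legendre
    -- parameter.
    have h₂ : V.a₂ = -(1 + V.a₄) := by rw [← hm]; rfl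
    rw [show Nat.factorial 3 = 6 from rfl, zero_smul, zero_smul, add_zero, zero_add, one_smul,
      V.six_nsmul_sixthOp, h₁, h₂, map_sub, map_pow, ← Polynomial.smul_eq_C_mul, map_smul,
      Polynomial.aeval_X]
    module
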